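/- **Lemma 2.1 (Poincaré–Sobolev inequality in Lorentz spaces).** For a measurable (scalar or vector valued) function $g$ on a measurable set $\Omega\subset\mathbb R^n$ let $g_*(\alpha)=|\{x\in\Omega:|g(x)|>\alpha\}|$ be its distribution function, $g^*(t)=\inf\{\alpha>0: g_*(\alpha)\le t\}$ its decreasing rearrangement, and $$\|g\|_{L^{r,q}(\Omega)}=\Big(\int_0^\infty \big(t^{1/r}g^*(t)\big)^q\,\frac{dt}{t}\Big)^{1/q}\ (q<\infty),\qquad \|g\|_{L^{r,\infty}(\Omega)}=\sup_{t>0}t^{1/r}g^*(t).$$ Let $n\in\mathbb N$, let $p$ be a real number with $1<p<n$, and let $1\le q\le\infty$. Then there is a constant $C<\infty$ depending only on $n$, $p$ and $q$ such that for every $\varrho>0$, with $B(\varrho)=\{x\in\mathbb R^n:|x|\le\varrho\}$, and every real-valued $f\in L^1(B(\varrho))$ that has a locally integrable weak gradient $\nabla f$ in the interior of $B(\varrho)$, $$\|f-\overline f_{B(\varrho)}\|_{L^{\frac{pn}{n-p},\,q}(B(\varrho))}\le C\,\|\nabla f\|_{L^{p,q}(B(\varrho))},\qquad \overline f_{B(\varrho)}=\frac1{|B(\varrho)|}\int_{B(\varrho)}f(y)\,dy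 .$$ (The right-hand side may be infinite, in which case nothing is claimed.) -/

import Mathlib

open MeasureTheory Set Metric
open scoped ENNReal NNReal ContDiff

/-- The distribution function `f_*(α) = |{x ∈ Ω : |f x| > α}|` of a (scalar- or vector-valued)
function `f` on `Ω ⊆ ℝⁿ`, where `|·|` of a set is Lebesgue measure. -/
noncomputable def distribFun {n : ℕ} {F : Type*} [NormedAddCommGroup F]
    (f : EuclideanSpace ℝ (Fin n) → F) (Ω : Set (EuclideanSpace ℝ (Fin n))) (α : ℝ≥0∞) : ℝ≥0∞ :=
  volume {x ∈ Ω | α < ‖f x‖ₑ}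

/-- The decreasing rearrangement `f^*(t) = inf {α > 0 : f_*(α) ≤ t}`, with values in `[0, ∞]`.
(The value `α = ∞` always lies in the set, so the infimum is `∞` when no finite `α` does.) -/
noncomputable def decRearr {n : ℕ} {F : Type*} [NormedAddCommGroup F]
    (f : EuclideanSpace ℝ (Fin n) → F) (Ω : Set (EuclideanSpace ℝ (Fin n))) (t : ℝ≥0∞) : ℝ≥0∞ :=
  sInf {α : ℝ≥0∞ | 0 < α ∧ distribFun f Ω α ≤ t}

/-- The Lorentz quasi-norm `‖f‖_{L^{p,q}(Ω)} ∈ [0, ∞]` for `p, q ∈ [1, ∞]`: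
`(∫₀^∞ (t^{1/p} f^*(t))^q dt/t)^{1/q}` if `q < ∞`, and `sup_{t > 0} t^{1/p} f^*(t)` if `q = ∞`. -/
noncomputable def lorentzNorm {n : ℕ} {F : Type*} [NormedAddCommGroup F]
    (f : EuclideanSpace ℝ (Fin n) → F) (p q : ℝ≥0∞) (Ω : Set (EuclideanSpace ℝ (Fin n))) : ℝ≥0∞ :=
  if q = ⊤ then
    ⨆ (t : ℝ) (_ : 0 < t), ENNReal.ofReal t ^ (p⁻¹).toReal * decRearr f Ω (ENNReal.ofReal t)
  else
    (∫⁻ t in Ioi (0 : ℝ),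
      (ENNReal.ofReal t ^ (p⁻¹).toReal * decRearr f Ω (ENNReal.ofReal t)) ^ q.toReal
        / ENNReal.ofReal t) ^ (q.toReal)⁻¹

/-- `G` is the weak (distributional) gradient of `f` on the open set `U ⊆ ℝⁿ`: both are locally
integrable on `U` and `∫_U f ∂_v φ = - ∫_U ⟨G, v⟩ φ` for all directions `v` and all
`φ ∈ C_c^∞(U)`. -/
structure HasWeakGradientOn {n : ℕ} (f : EuclideanSpace ℝ (Fin n) → ℝ)
    (G : EuclideanSpace ℝ (Fin n) → EuclideanSpace ℝ (Fin n))
    (U : Set (EuclideanSpace ℝ (Fin n))) : Prop where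
  locallyIntegrableOn : LocallyIntegrableOn f U
  locallyIntegrableOn_grad : LocallyIntegrableOn G U
  integral_eq : ∀ φ : EuclideanSpace ℝ (Fin n) → ℝ, ContDiff ℝ ∞ φ → HasCompactSupport φ →
    tsupport φ ⊆ U → ∀ v : EuclideanSpace ℝ (Fin n),
      ∫ x in U, f x * fderiv ℝ φ x v = - ∫ x in U, inner ℝ (G x) v * φ x

/-!
The proof reduces the inequality to a pointwise potential estimate followed by two
rearrangement-invariant inequalities.

*Potential estimate.* For a `C¹` function `u` on a ball, integrating `∇u` along segments from a fixed
point `x` gives `∫_B |u x - u y| dy ≤ C ρⁿ ∫_B |x - z|^{1-n} |∇u z| dz`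
(`lintegral_enorm_sub_le_of_contDiff`). For weakly differentiable `f` this is applied to
mollifications of `f` on smaller balls: their gradients are dominated by mollifications of `|∇f|`, and
mollifying commutes with the Riesz potential, so Fatou's lemma on the left and Lebesgue
differentiation of the Riesz potential on the right give the same bound for `f` almost everywhere
(`HasWeakGradientOn.ae_lintegral_enorm_sub_le`). Only local integrability of `∇f` is used, since the
potential is exhausted from inside. Dividing by `|B|` bounds `|f - f_B|` by a constant, independent of
the radius, times the potential of `|∇f|`.

*O'Neil's inequality.* The kernel satisfies `∫_A |x - y|^{1-n} dy ≤ C |A|^{1/n}` for every set `A`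
(`exists_lintegral_rieszKernel_le`). To bound `w^*(t)` for `w ≤ I g`, split `g` at the level
`g^*(t)`: the potential of the lower part is bounded by the layer-cake formula, that of the upper part
is of weak type `(1, n/(n-1))`, and both follow from the kernel bound. The outcome is
`w^*(t) ≤ C (t^{1/n-1} ∫_0^t g^* + ∫_t^∞ s^{1/n-1} g^*(s) ds)` (`decRearr_le_of_le_rieszKernel`).

*Hardy's inequality.* Multiplied by `t^{1/p-1/n}`, the right-hand side is an average
`∫_0^∞ k(u) h(tu) du` of dilates of `h(s) = s^{1/p} g^*(s)`, with `k` integrable exactly because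
`1 < p < n`. As `dt/t` is invariant under dilations, such averages are bounded on `L^q(dt/t)` for all
`1 ≤ q ≤ ∞` (`lorentzNorm_le_of_decRearr_le`).
-/

/-! ### Power integrals and the Riesz kernel -/

theorem lintegral_ofReal_rpow_Ioi {a c : ℝ} (ha : a < -1) (hc : 0 < c) :
    ∫⁻ s in Ioi c, ENNReal.ofReal (s ^ a) = ENNReal.ofReal (-c ^ (a + 1) / (a + 1)) := by
  rw [← integral_Ioi_rpow_of_lt ha hc,
    ofReal_integral_eq_lintegral_ofReal (integrableOn_Ioi_rpow_of_lt ha hc)]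
  filter_upwards [ae_restrict_mem measurableSet_Ioi] with s hs
  exact Real.rpow_nonneg (hc.le.trans (le_of_lt hs)) _

theorem lintegral_ofReal_rpow_Ioc {a c : ℝ} (ha : -1 < a) (hc : 0 ≤ c) :
    ∫⁻ s in Ioc 0 c, ENNReal.ofReal (s ^ a) = ENNReal.ofReal (c ^ (a + 1) / (a + 1)) := by
  have h1 : ∫ s in Ioc 0 c, s ^ a = c ^ (a + 1) / (a + 1) := by
    rw [← intervalIntegral.integral_of_le hc, integral_rpow (Or.inl ha),
      Real.zero_rpow (by linarith), sub_zero]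
  rw [← h1, ofReal_integral_eq_lintegral_ofReal]
  · exact (intervalIntegrable_iff_integrableOn_Ioc_of_le hc).1
      (intervalIntegral.intervalIntegrable_rpow' ha)
  · filter_upwards [ae_restrict_mem measurableSet_Ioc] with s hs
    exact Real.rpow_nonneg hs.1.le _

/-- The kernel `|x|^{1-n}` of the Riesz potential of order one on `ℝⁿ`. The real power gives it
the value `0` at the origin when `n ≥ 2`. -/
noncomputable def rieszKernel {n : ℕ} (x : EuclideanSpace ℝ (Fin n)) : ℝ≥0∞ :=
  ENNReal.ofReal (‖x‖ ^ (1 - n : ℝ))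

/-- The Riesz potential of order one of a nonnegative function, without normalizing constant. -/
noncomputable def rieszPotential {n : ℕ} (g : EuclideanSpace ℝ (Fin n) → ℝ≥0∞)
    (x : EuclideanSpace ℝ (Fin n)) : ℝ≥0∞ :=
  ∫⁻ z, rieszKernel (x - z) * g z

@[fun_prop]
theorem measurable_rieszKernel {n : ℕ} :
    Measurable (rieszKernel : EuclideanSpace ℝ (Fin n) → ℝ≥0∞) := by
  unfold rieszKernel
  fun_prop

theorem measurable_rieszPotential {n : ℕ} {g : EuclideanSpace ℝ (Fin n) → ℝ≥0∞}
    (hg : Measurable g) : Measurable (rieszPotential g) := by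
  unfold rieszPotential
  refine Measurable.lintegral_prod_right' (f := fun q : EuclideanSpace ℝ (Fin n) × _ =>
    rieszKernel (q.1 - q.2) * g q.2) ?_
  fun_prop

/-- The Riesz kernel as a superposition of indicators of balls,
`|z|^{1-n} = (n-1) ∫_{|z|}^∞ s^{-n} ds`. Only the inequality is stated: at `z = 0` the kernel has the junk value `0`. -/
theorem rieszKernel_le_lintegral {n : ℕ} (hn : 2 ≤ n) (z : EuclideanSpace ℝ (Fin n)) :
    rieszKernel z ≤
      ∫⁻ s in Ioi (0 : ℝ), ENNReal.ofReal ((n - 1) * s ^ (-n : ℝ)) * (Ioi ‖z‖).indicator 1 s := by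
  have hn' : (2 : ℝ) ≤ n := by exact_mod_cast hn
  rcases eq_or_ne z 0 with rfl | hz
  · simp only [rieszKernel, norm_zero]
    rw [Real.zero_rpow (by linarith)]
    simp
  have hz' : 0 < ‖z‖ := norm_pos_iff.2 hz
  have h1 : ∀ s : ℝ, ENNReal.ofReal ((n - 1) * s ^ (-n : ℝ)) * (Ioi ‖z‖).indicator 1 s
      = (Ioi ‖z‖).indicator (fun s => ENNReal.ofReal ((n - 1) * s ^ (-n : ℝ))) s := by
    intro s
    by_cases h : s ∈ Ioi ‖z‖ <;> simp [h]
  simp_rw [h1]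
  rw [lintegral_indicator measurableSet_Ioi, Measure.restrict_restrict measurableSet_Ioi,
    inter_eq_left.2 (Ioi_subset_Ioi hz'.le)]
  simp_rw [ENNReal.ofReal_mul (show (0 : ℝ) ≤ n - 1 by linarith)]
  rw [lintegral_const_mul _ (by fun_prop), lintegral_ofReal_rpow_Ioi (by linarith) hz',
    ← ENNReal.ofReal_mul (by linarith), rieszKernel]
  apply ENNReal.ofReal_le_ofReal
  have : (-n + 1 : ℝ) = 1 - n := by ring
  rw [this]
  have h3 : (1 - n : ℝ) ≠ 0 := by linarith
  apply le_of_eq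
  field_simp
  ring

/-- Among all sets of given measure, a ball centred at the singularity makes the integral of the
Riesz kernel largest, up to a constant. -/
theorem exists_lintegral_rieszKernel_le {n : ℕ} (hn : 2 ≤ n) :
    ∃ C : ℝ≥0, 0 < C ∧ ∀ (A : Set (EuclideanSpace ℝ (Fin n))) (x : EuclideanSpace ℝ (Fin n)),
      ∫⁻ y in A, rieszKernel (x - y) ≤ C * volume A ^ (1 / n : ℝ) := by
  have hn' : (2 : ℝ) ≤ n := by exact_mod_cast hn
  have hn0 : (n : ℝ) ≠ 0 := by linarith
  set v : ℝ := (volume (ball (0 : EuclideanSpace ℝ (Fin n)) 1)).toReal with hv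
  have hv0 : 0 ≤ v := ENNReal.toReal_nonneg
  have hC : (1 : ℝ) ≤ (n - 1) * v + 1 := by nlinarith
  refine ⟨((n - 1) * v + 1).toNNReal, Real.toNNReal_pos.2 (by linarith), fun A x => ?_⟩
  rcases eq_or_ne (volume A) 0 with hA0 | hA0
  · rw [Measure.restrict_eq_zero.2 hA0]
    simp
  rcases eq_or_ne (volume A) ⊤ with hAt | hAt
  · rw [hAt, ENNReal.top_rpow_of_pos (by positivity), ENNReal.mul_top]
    · exact le_top
    · simp only [ne_eq, ENNReal.coe_eq_zero, Real.toNNReal_eq_zero, not_le]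
      linarith
  set m : ℝ := (volume A).toReal with hm
  have hm0 : 0 < m := ENNReal.toReal_pos hA0 hAt
  have hAm : volume A = ENNReal.ofReal m := (ENNReal.ofReal_toReal hAt).symm
  -- the radius of a ball of measure comparable to that of `A`
  set R : ℝ := m ^ (1 / n : ℝ) with hR
  have hR0 : 0 < R := Real.rpow_pos_of_pos hm0 _
  calc ∫⁻ y in A, rieszKernel (x - y)
      ≤ ∫⁻ y in A, ∫⁻ s in Ioi (0 : ℝ),
          ENNReal.ofReal ((n - 1) * s ^ (-n : ℝ)) * (Ioi ‖x - y‖).indicator 1 s :=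
        lintegral_mono fun y => rieszKernel_le_lintegral hn _
    _ = ∫⁻ s in Ioi (0 : ℝ), ∫⁻ y in A,
          ENNReal.ofReal ((n - 1) * s ^ (-n : ℝ)) * (Ioi ‖x - y‖).indicator 1 s := by
        apply lintegral_lintegral_swap
        refine Measurable.aemeasurable ?_
        refine Measurable.mul (by fun_prop) ?_
        exact measurable_one.indicator (s := {q : EuclideanSpace ℝ (Fin n) × ℝ | ‖x - q.1‖ < q.2})
          (measurableSet_lt (by fun_prop) (by fun_prop))
    _ ≤ ∫⁻ s in Ioi (0 : ℝ), ENNReal.ofReal ((n - 1) * s ^ (-n : ℝ)) *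
          min (volume A) (ENNReal.ofReal (s ^ n * v)) := by
        refine setLIntegral_mono' measurableSet_Ioi fun s hs => ?_
        rw [lintegral_const_mul' _ _ ENNReal.ofReal_ne_top]
        gcongr
        have h1 : ∀ y, (Ioi ‖x - y‖).indicator (1 : ℝ → ℝ≥0∞) s = (ball x s).indicator 1 y := by
          intro y
          simp [indicator, dist_eq_norm, norm_sub_rev]
        simp_rw [h1]
        rw [lintegral_indicator_one measurableSet_ball]
        refine le_min ?_ ?_
        · exact (measure_mono (subset_univ _)).trans (by simp)
        · refine (Measure.restrict_apply_le _ _).trans ?_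
          rw [Measure.addHaar_ball_of_pos _ _ hs, finrank_euclideanSpace_fin,
            ENNReal.ofReal_mul (pow_nonneg (le_of_lt hs) _), hv,
            ENNReal.ofReal_toReal measure_ball_lt_top.ne]
    -- below radius `R` the volume of the ball is the smaller term, above it the measure of `A`
    _ ≤ (∫⁻ s in Ioc 0 R, ENNReal.ofReal ((n - 1) * v)) +
          ∫⁻ s in Ioi R, ENNReal.ofReal ((n - 1) * m) * ENNReal.ofReal (s ^ (-n : ℝ)) := by
        rw [← Ioc_union_Ioi_eq_Ioi hR0.le]
        refine (lintegral_union_le _ _ _).trans ?_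
        refine add_le_add (setLIntegral_mono' measurableSet_Ioc fun s hs => ?_)
          (setLIntegral_mono' measurableSet_Ioi fun s hs => ?_)
        · refine (mul_le_mul_right (min_le_right _ _) _).trans ?_
          have hs0 : 0 < s := hs.1
          rw [← ENNReal.ofReal_mul (mul_nonneg (by linarith) (Real.rpow_nonneg hs0.le _))]
          apply ENNReal.ofReal_le_ofReal
          rw [Real.rpow_neg hs0.le, Real.rpow_natCast]
          apply le_of_eq
          field_simp
        · refine (mul_le_mul_right (min_le_left _ _) _).trans ?_
          have hs0 : 0 < s := hR0.trans hs
          rw [hAm, ← ENNReal.ofReal_mul (mul_nonneg (by linarith) (Real.rpow_nonneg hs0.le _)),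
            ← ENNReal.ofReal_mul (mul_nonneg (by linarith) hm0.le)]
          apply ENNReal.ofReal_le_ofReal
          apply le_of_eq
          ring
    _ = ↑((n - 1) * v + 1).toNNReal * volume A ^ (1 / n : ℝ) := by
        rw [lintegral_const_mul _ (by fun_prop), lintegral_ofReal_rpow_Ioi (by linarith) hR0,
          setLIntegral_const, Real.volume_Ioc, hAm, ENNReal.ofReal_rpow_of_pos hm0, ← hR, sub_zero]
        change _ = ENNReal.ofReal _ * _
        rw [← ENNReal.ofReal_mul (by nlinarith), ← ENNReal.ofReal_mul (by nlinarith),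
          ← ENNReal.ofReal_mul (by linarith), ← ENNReal.ofReal_add]
        · congr 1
          have h2 : R ^ (-n + 1 : ℝ) = R / m := by
            rw [Real.rpow_add hR0, Real.rpow_one, Real.rpow_neg hR0.le, hR, ← Real.rpow_mul hm0.le,
              one_div_mul_cancel hn0, Real.rpow_one]
            ring
          rw [h2]
          have h3 : (-n + 1 : ℝ) ≠ 0 := by linarith
          field_simp
          ring
        · exact mul_nonneg (mul_nonneg (by linarith) hv0) hR0.le
        · refine mul_nonneg (mul_nonneg (by linarith) hm0.le) ?_
          exact div_nonneg_of_nonpos (by have := Real.rpow_nonneg hR0.le (-n + 1 : ℝ); linarith)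
            (by linarith)

/-! ### Distribution functions and layer-cake estimates -/

theorem distribFun_antitone {n : ℕ} {F : Type*} [NormedAddCommGroup F]
    (f : EuclideanSpace ℝ (Fin n) → F) (Ω : Set (EuclideanSpace ℝ (Fin n))) :
    Antitone (distribFun f Ω) := fun _ _ h =>
  measure_mono fun _ hx => ⟨hx.1, h.trans_lt hx.2⟩

theorem decRearr_antitone {n : ℕ} {F : Type*} [NormedAddCommGroup F]
    (f : EuclideanSpace ℝ (Fin n) → F) (Ω : Set (EuclideanSpace ℝ (Fin n))) :
    Antitone (decRearr f Ω) := fun _ _ h =>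
  sInf_le_sInf fun _ hα => ⟨hα.1, hα.2.trans h⟩

/-- The only relation between distribution function and decreasing rearrangement that is needed: it
uses monotonicity alone, and no right continuity. -/
theorem le_decRearr_of_lt_distribFun {n : ℕ} {F : Type*} [NormedAddCommGroup F]
    {f : EuclideanSpace ℝ (Fin n) → F} {Ω : Set (EuclideanSpace ℝ (Fin n))} {α t : ℝ≥0∞}
    (h : t < distribFun f Ω α) : α ≤ decRearr f Ω t := by
  refine le_sInf fun β hβ => ?_
  by_contra! hlt
  exact absurd (h.trans_le (distribFun_antitone f Ω hlt.le)) (not_lt.2 hβ.2)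

theorem lintegral_Ioi_indicator_lt (m : ℝ≥0∞) :
    ∫⁻ a in Ioi (0 : ℝ), {a : ℝ | ENNReal.ofReal a < m}.indicator (fun _ => 1) a = m := by
  rw [lintegral_indicator (measurableSet_lt (by fun_prop) (by fun_prop)),
    Measure.restrict_restrict (measurableSet_lt (by fun_prop) (by fun_prop)), setLIntegral_one]
  rcases eq_or_ne m ⊤ with rfl | hm
  · have : {a : ℝ | ENNReal.ofReal a < ⊤} ∩ Ioi 0 = Ioi 0 := by
      ext; simp
    rw [this, Real.volume_Ioi]
  · have : {a : ℝ | ENNReal.ofReal a < m} ∩ Ioi 0 = Ioo 0 m.toReal := by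
      ext a
      simp only [mem_inter_iff, mem_ofPred_eq, mem_Ioi, mem_Ioo]
      constructor
      · rintro ⟨h1, h2⟩
        exact ⟨h2, (ENNReal.ofReal_lt_iff_lt_toReal h2.le hm).1 h1⟩
      · rintro ⟨h1, h2⟩
        exact ⟨(ENNReal.ofReal_lt_iff_lt_toReal h1.le hm).2 h2, h1⟩
    rw [this, Real.volume_Ioo, sub_zero, ENNReal.ofReal_toReal hm]

theorem lintegral_Ioi_indicator_le (m : ℝ≥0∞) :
    ∫⁻ a in Ioi (0 : ℝ), {a : ℝ | ENNReal.ofReal a ≤ m}.indicator (fun _ => 1) a = m := by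
  rw [lintegral_indicator (measurableSet_le (by fun_prop) (by fun_prop)),
    Measure.restrict_restrict (measurableSet_le (by fun_prop) (by fun_prop)), setLIntegral_one]
  rcases eq_or_ne m ⊤ with rfl | hm
  · simp
  · have : {a : ℝ | ENNReal.ofReal a ≤ m} ∩ Ioi 0 = Ioc 0 m.toReal := by
      ext a
      simp only [mem_inter_iff, mem_ofPred_eq, mem_Ioi, mem_Ioc]
      constructor
      · rintro ⟨h1, h2⟩
        exact ⟨h2, (ENNReal.ofReal_le_iff_le_toReal hm).1 h1⟩
      · rintro ⟨h1, h2⟩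
        exact ⟨(ENNReal.ofReal_le_iff_le_toReal hm).2 h2, h1⟩
    rw [this, Real.volume_Ioc, sub_zero, ENNReal.ofReal_toReal hm]

/-- Layer-cake formula against a second measure: the integral of a weight over the superlevel sets
of `g`, integrated over the level, is the integral of `g` times the weight. -/
theorem lintegral_mul_eq_lintegral_superlevel {X : Type*} [MeasurableSpace X] (μ : Measure X)
    [SFinite μ] {g k : X → ℝ≥0∞} (hg : Measurable g) (hk : Measurable k) :
    ∫⁻ y, k y * g y ∂μ =
      ∫⁻ a in Ioi (0 : ℝ), ∫⁻ y in {y | ENNReal.ofReal a < g y}, k y ∂μ := by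
  have h1 : ∀ y, k y * g y = ∫⁻ a in Ioi (0 : ℝ),
      k y * {a : ℝ | ENNReal.ofReal a < g y}.indicator (fun _ => 1) a := by
    intro y
    rw [lintegral_const_mul, lintegral_Ioi_indicator_lt]
    exact measurable_const.indicator (measurableSet_lt (by fun_prop) (by fun_prop))
  simp_rw [h1]
  rw [lintegral_lintegral_swap]
  · refine lintegral_congr fun a => ?_
    rw [← lintegral_indicator (measurableSet_lt (by fun_prop) (by fun_prop))]
    refine lintegral_congr fun y => ?_
    simp [indicator]
  · refine Measurable.aemeasurable ((hk.comp measurable_fst).mul ?_)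
    exact measurable_const.indicator (s := {q : X × ℝ | ENNReal.ofReal q.2 < g q.1})
      (measurableSet_lt (by fun_prop) (by fun_prop))


/-- The layer-cake form `m^θ = ∫_0^m θ s^{θ-1} ds` of a power. -/
theorem rpow_le_lintegral_indicator {θ : ℝ} (hθ : 0 < θ) {m : ℝ≥0∞} (hm : m ≠ ⊤) :
    m ^ θ ≤ ∫⁻ s in Ioi (0 : ℝ),
      ENNReal.ofReal (θ * s ^ (θ - 1)) * {s : ℝ | ENNReal.ofReal s < m}.indicator (fun _ => 1) s := by
  have hm0 : (0 : ℝ) ≤ m.toReal := ENNReal.toReal_nonneg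
  have h1 : m ^ θ = ∫⁻ s in Ioc 0 m.toReal, ENNReal.ofReal (θ * s ^ (θ - 1)) := by
    simp_rw [ENNReal.ofReal_mul hθ.le]
    rw [lintegral_const_mul _ (by fun_prop), lintegral_ofReal_rpow_Ioc (by linarith) hm0,
      ← ENNReal.ofReal_mul hθ.le, sub_add_cancel, mul_div_cancel₀ _ hθ.ne',
      ← ENNReal.ofReal_rpow_of_nonneg hm0 hθ.le, ENNReal.ofReal_toReal hm]
  rw [h1, ← Measure.restrict_congr_set Ioo_ae_eq_Ioc,
    ← inter_eq_left.2 (Ioo_subset_Ioi_self : Ioo (0 : ℝ) m.toReal ⊆ Ioi 0),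
    ← Measure.restrict_restrict measurableSet_Ioo, ← lintegral_indicator measurableSet_Ioo]
  refine lintegral_mono fun s => ?_
  by_cases hs : s ∈ Ioo 0 m.toReal
  · have : ENNReal.ofReal s < m := (ENNReal.ofReal_lt_iff_lt_toReal hs.1.le hm).2 hs.2
    simp [hs.1, hs.2, this]
  · simp [indicator_of_notMem hs]

/-- The part of `g` above the level `R t` has integral at most that of `R` over `(0, t)`, where
`R` dominates the decreasing rearrangement of `g`. -/
theorem lintegral_tsub_le_of_superlevel {X : Type*} [MeasurableSpace X] (μ : Measure X)
    [SFinite μ] {g : X → ℝ≥0∞} (hg : Measurable g) {R : ℝ≥0∞ → ℝ≥0∞} (hR : Antitone R)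
    (h : ∀ a s, s < μ {y | a < g y} → a ≤ R s) {t : ℝ} (ht : 0 ≤ t)
    (hfin : R (ENNReal.ofReal t) ≠ ⊤) :
    ∫⁻ y, (g y - R (ENNReal.ofReal t)) ∂μ ≤ ∫⁻ s in Ioc 0 t, R (ENNReal.ofReal s) := by
  set l := R (ENNReal.ofReal t)
  have hR' : Measurable fun s : ℝ => R (ENNReal.ofReal s) :=
    hR.measurable.comp ENNReal.measurable_ofReal
  calc ∫⁻ y, (g y - l) ∂μ
      = ∫⁻ a in Ioi (0 : ℝ), μ {y | l + ENNReal.ofReal a < g y} := by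
        have := lintegral_mul_eq_lintegral_superlevel μ (hg.sub_const l)
          (measurable_const (a := (1 : ℝ≥0∞)))
        simpa [lt_tsub_iff_left] using this
    _ = ∫⁻ a in Ioi (0 : ℝ), ∫⁻ s in Ioi (0 : ℝ),
          {s : ℝ | ENNReal.ofReal s < μ {y | l + ENNReal.ofReal a < g y}}.indicator
            (fun _ => 1) s := by
        simp_rw [lintegral_Ioi_indicator_lt]
    _ ≤ ∫⁻ a in Ioi (0 : ℝ), ∫⁻ s in Ioi (0 : ℝ),
          {a : ℝ | ENNReal.ofReal a ≤ R (ENNReal.ofReal s) - l}.indicator (fun _ => 1) a := by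
        refine lintegral_mono fun a => lintegral_mono fun s => ?_
        by_cases hs : ENNReal.ofReal s < μ {y | l + ENNReal.ofReal a < g y}
        · have : ENNReal.ofReal a ≤ R (ENNReal.ofReal s) - l :=
            ENNReal.le_sub_of_add_le_left hfin (h _ _ hs)
          have hmem : a ∈ {a : ℝ | ENNReal.ofReal a ≤ R (ENNReal.ofReal s) - l} := this
          rw [indicator_of_mem hmem]
          exact indicator_le_self _ _ _
        · simp [hs]
    _ = ∫⁻ s in Ioi (0 : ℝ), (R (ENNReal.ofReal s) - l) := by
        rw [lintegral_lintegral_swap]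
        · simp_rw [lintegral_Ioi_indicator_le]
        · refine Measurable.aemeasurable ?_
          exact measurable_const.indicator
            (s := {q : ℝ × ℝ | ENNReal.ofReal q.1 ≤ R (ENNReal.ofReal q.2) - l})
            (measurableSet_le (by fun_prop) ((hR'.comp measurable_snd).sub_const _))
    _ ≤ ∫⁻ s in Ioc 0 t, R (ENNReal.ofReal s) := by
        rw [← Ioc_union_Ioi_eq_Ioi ht]
        refine (lintegral_union_le _ _ _).trans ?_
        have h0 : ∫⁻ s in Ioi t, (R (ENNReal.ofReal s) - l) = 0 := by
          rw [setLIntegral_congr_fun (g := fun _ => 0) measurableSet_Ioi, lintegral_zero]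
          intro s hs
          exact tsub_eq_zero_of_le (hR (ENNReal.ofReal_le_ofReal (le_of_lt hs)))
        rw [h0, add_zero]
        exact lintegral_mono fun s => tsub_le_self

/-- The integral of a truncated function against a kernel `k` whose integral over every set `A` is
at most `C * μ A ^ θ`, bounded through a function `R` dominating the decreasing rearrangement. -/
theorem lintegral_mul_min_le_of_superlevel {X : Type*} [MeasurableSpace X] (μ : Measure X)
    [IsFiniteMeasure μ] {g k : X → ℝ≥0∞} (hg : Measurable g) (hk : Measurable k)
    {R : ℝ≥0∞ → ℝ≥0∞} (hR : Antitone R) (h : ∀ a s, s < μ {y | a < g y} → a ≤ R s)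
    {θ : ℝ} (hθ : 0 < θ) {C : ℝ≥0} (hC : ∀ A, ∫⁻ y in A, k y ∂μ ≤ C * μ A ^ θ) (l : ℝ≥0∞) :
    ∫⁻ y, k y * min (g y) l ∂μ ≤
      C * ∫⁻ s in Ioi (0 : ℝ), ENNReal.ofReal (θ * s ^ (θ - 1)) * min l (R (ENNReal.ofReal s)) := by
  have hR' : Measurable fun s : ℝ => R (ENNReal.ofReal s) :=
    hR.measurable.comp ENNReal.measurable_ofReal
  calc ∫⁻ y, k y * min (g y) l ∂μ
      = ∫⁻ a in Ioi (0 : ℝ), ∫⁻ y in {y | ENNReal.ofReal a < min (g y) l}, k y ∂μ :=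
        lintegral_mul_eq_lintegral_superlevel μ (hg.min measurable_const) hk
    _ ≤ ∫⁻ a in Ioi (0 : ℝ), C * μ {y | ENNReal.ofReal a < min (g y) l} ^ θ :=
        lintegral_mono fun a => hC _
    _ ≤ ∫⁻ a in Ioi (0 : ℝ), C * ∫⁻ s in Ioi (0 : ℝ), ENNReal.ofReal (θ * s ^ (θ - 1)) *
          {a : ℝ | ENNReal.ofReal a ≤ min l (R (ENNReal.ofReal s))}.indicator (fun _ => 1) a := by
        refine lintegral_mono fun a => ?_
        gcongr
        refine (rpow_le_lintegral_indicator hθ (measure_ne_top _ _)).trans ?_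
        refine lintegral_mono fun s => ?_
        gcongr
        by_cases hs : ENNReal.ofReal s < μ {y | ENNReal.ofReal a < min (g y) l}
        · have h1 : ENNReal.ofReal a ≤ R (ENNReal.ofReal s) := by
            refine h _ _ (hs.trans_le (measure_mono fun y hy => ?_))
            exact (mem_ofPred_eq.mp hy).trans_le (min_le_left _ _)
          have h2 : ENNReal.ofReal a ≤ l := by
            obtain ⟨y, hy⟩ : {y | ENNReal.ofReal a < min (g y) l}.Nonempty :=
              nonempty_of_measure_ne_zero (bot_lt_of_lt hs).ne'
            exact ((mem_ofPred_eq.mp hy).trans_le (min_le_right _ _)).le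
          have hmem : a ∈ {a : ℝ | ENNReal.ofReal a ≤ min l (R (ENNReal.ofReal s))} :=
            le_min h2 h1
          rw [indicator_of_mem hmem]
          exact indicator_le_self _ _ _
        · have hmem : s ∉ {s : ℝ | ENNReal.ofReal s < μ {y | ENNReal.ofReal a < min (g y) l}} := hs
          rw [indicator_of_notMem hmem]
          exact bot_le
    _ = C * ∫⁻ s in Ioi (0 : ℝ), ENNReal.ofReal (θ * s ^ (θ - 1)) *
          min l (R (ENNReal.ofReal s)) := by
        rw [lintegral_const_mul' _ _ ENNReal.coe_ne_top, lintegral_lintegral_swap]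
        · congr 1
          refine lintegral_congr fun s => ?_
          rw [lintegral_const_mul' _ _ ENNReal.ofReal_ne_top, lintegral_Ioi_indicator_le]
        · refine Measurable.aemeasurable (Measurable.mul (by fun_prop) ?_)
          exact measurable_const.indicator
            (s := {q : ℝ × ℝ | ENNReal.ofReal q.1 ≤ min l (R (ENNReal.ofReal q.2))})
            (measurableSet_le (by fun_prop) (measurable_const.min (hR'.comp measurable_snd)))

/-! ### O'Neil's inequality for the Riesz potential -/

theorem rieszKernel_sub_comm {n : ℕ} (x y : EuclideanSpace ℝ (Fin n)) :
    rieszKernel (x - y) = rieszKernel (y - x) := by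
  simp only [rieszKernel, norm_sub_rev]

/-- The weak-type bound for the Riesz potential on `L¹`, in integrated form: averaging the potential
over a superlevel set `T` moves the kernel bound onto `T`. -/
theorem mul_measure_le_of_le_rieszKernel {n : ℕ} {C : ℝ≥0}
    {μ : Measure (EuclideanSpace ℝ (Fin n))} [SFinite μ]
    (hC : ∀ A x, ∫⁻ y in A, rieszKernel (x - y) ∂μ ≤ C * μ A ^ (1 / n : ℝ))
    {g : EuclideanSpace ℝ (Fin n) → ℝ≥0∞} (hg : Measurable g)
    {T : Set (EuclideanSpace ℝ (Fin n))} (hT : MeasurableSet T) {c : ℝ≥0∞}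
    (h : ∀ x ∈ T, c ≤ ∫⁻ y, rieszKernel (x - y) * g y ∂μ) :
    c * μ T ≤ C * μ T ^ (1 / n : ℝ) * ∫⁻ y, g y ∂μ := by
  calc c * μ T = ∫⁻ x in T, c ∂μ := by rw [setLIntegral_const]
    _ ≤ ∫⁻ x in T, ∫⁻ y, rieszKernel (x - y) * g y ∂μ ∂μ := setLIntegral_mono' hT h
    _ = ∫⁻ y, ∫⁻ x in T, rieszKernel (x - y) * g y ∂μ ∂μ := by
        apply lintegral_lintegral_swap
        fun_prop
    _ ≤ ∫⁻ y, C * μ T ^ (1 / n : ℝ) * g y ∂μ := by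
        refine lintegral_mono fun y => ?_
        rw [lintegral_mul_const _ (by fun_prop)]
        gcongr
        simp_rw [fun x => rieszKernel_sub_comm x y]
        exact hC T y
    _ = _ := lintegral_const_mul _ hg

/-- **O'Neil's inequality** for functions dominated by a Riesz potential. -/
theorem decRearr_le_of_le_rieszKernel {n : ℕ} (hn : 2 ≤ n) {F F' : Type*}
    [NormedAddCommGroup F] [NormedAddCommGroup F'] {C : ℝ≥0} (hC0 : 0 < C)
    (hC : ∀ (A : Set (EuclideanSpace ℝ (Fin n))) (x : EuclideanSpace ℝ (Fin n)),
      ∫⁻ y in A, rieszKernel (x - y) ≤ C * volume A ^ (1 / n : ℝ))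
    {B : Set (EuclideanSpace ℝ (Fin n))} (hB : MeasurableSet B) (hBfin : volume B ≠ ⊤)
    {w : EuclideanSpace ℝ (Fin n) → F} {G : EuclideanSpace ℝ (Fin n) → F'}
    (hG : AEStronglyMeasurable G (volume.restrict B)) {K : ℝ≥0} (hK : 0 < K)
    (hw : ∀ᵐ x ∂volume.restrict B, ‖w x‖ₑ ≤ K * ∫⁻ y in B, rieszKernel (x - y) * ‖G y‖ₑ)
    {t : ℝ} (ht : 0 < t) :
    decRearr w B (ENNReal.ofReal t) ≤ (2 * K * C : ℝ≥0) *
      (ENNReal.ofReal (t ^ (1 / n - 1 : ℝ)) * (∫⁻ s in Ioc 0 t, decRearr G B (ENNReal.ofReal s)) +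
        ∫⁻ s in Ioi t, ENNReal.ofReal (s ^ (1 / n - 1 : ℝ)) * decRearr G B (ENNReal.ofReal s)) := by
  have hn' : (2 : ℝ) ≤ n := by exact_mod_cast hn
  set θ : ℝ := 1 / n with hθ
  have hθ0 : 0 < θ := by positivity
  have hθ1 : θ < 1 := by rw [hθ, div_lt_one (by linarith)]; linarith
  set μ := volume.restrict B with hμ
  have : IsFiniteMeasure μ := ⟨by simpa [hμ] using hBfin.lt_top⟩
  have hCμ : ∀ A x, ∫⁻ y in A, rieszKernel (x - y) ∂μ ≤ C * μ A ^ θ := by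
    intro A x
    rw [hμ, Measure.restrict_restrict' hB, Measure.restrict_apply' hB]
    exact hC _ _
  set R := decRearr G B with hR
  have hRanti : Antitone R := decRearr_antitone G B
  obtain ⟨g, hg, hGg⟩ := hG.enorm
  have hsuper : ∀ a s, s < μ {y | a < g y} → a ≤ R s := by
    intro a s hs
    refine le_decRearr_of_lt_distribFun (hs.trans_eq ?_)
    have : μ {y | a < g y} = μ {y | a < ‖G y‖ₑ} := by
      apply measure_congr
      filter_upwards [hGg] with y hy
      change (a < g y) = (a < ‖G y‖ₑ)
      rw [hy]
    rw [this, hμ, Measure.restrict_apply' hB, inter_comm]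
    rfl
  set l := R (ENNReal.ofReal t) with hl
  set P := ∫⁻ s in Ioc 0 t, R (ENNReal.ofReal s) with hP
  set Q := ∫⁻ s in Ioi t, ENNReal.ofReal (s ^ (θ - 1)) * R (ENNReal.ofReal s) with hQ
  have htθ : 0 < t ^ (θ - 1) := Real.rpow_pos_of_pos ht _
  have hlP : ENNReal.ofReal t * l ≤ P := by
    calc ENNReal.ofReal t * l = ∫⁻ s in Ioc 0 t, l := by
          rw [setLIntegral_const, Real.volume_Ioc, sub_zero, mul_comm]
      _ ≤ P := setLIntegral_mono' measurableSet_Ioc fun s hs =>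
          hRanti (ENNReal.ofReal_le_ofReal hs.2)
  have hM : (2 * K * C : ℝ≥0) ≠ 0 := by positivity
  -- when `P = ∞` the right-hand side is infinite, because the constant does not vanish
  rcases eq_or_ne P ⊤ with hPt | hPt
  · rw [hPt, ENNReal.mul_top (by simpa using htθ), top_add, ENNReal.mul_top (by exact_mod_cast hM)]
    exact le_top
  have hlt : l ≠ ⊤ := by
    intro h
    rw [h, ENNReal.mul_top (by simpa using ht)] at hlP
    exact hPt (top_le_iff.1 hlP)
  set I := ∫⁻ s in Ioi (0 : ℝ), ENNReal.ofReal (θ * s ^ (θ - 1)) * min l (R (ENNReal.ofReal s))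
    with hI
  have hIle : I ≤ ENNReal.ofReal (t ^ (θ - 1)) * P + Q := by
    rw [hI, ← Ioc_union_Ioi_eq_Ioi ht.le]
    refine (lintegral_union_le _ _ _).trans (add_le_add ?_ ?_)
    · calc ∫⁻ s in Ioc 0 t, ENNReal.ofReal (θ * s ^ (θ - 1)) * min l (R (ENNReal.ofReal s))
          ≤ ∫⁻ s in Ioc 0 t, ENNReal.ofReal θ * ENNReal.ofReal (s ^ (θ - 1)) * l := by
            refine lintegral_mono fun s => ?_
            rw [ENNReal.ofReal_mul hθ0.le]
            gcongr
            exact min_le_left _ _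
        _ = ENNReal.ofReal (t ^ (θ - 1)) * (ENNReal.ofReal t * l) := by
            rw [lintegral_mul_const _ (by fun_prop), lintegral_const_mul _ (by fun_prop),
              lintegral_ofReal_rpow_Ioc (by linarith) ht.le, ← mul_assoc,
              ← ENNReal.ofReal_mul hθ0.le, ← ENNReal.ofReal_mul htθ.le, sub_add_cancel,
              mul_div_cancel₀ _ hθ0.ne', Real.rpow_sub_one ht.ne', div_mul_cancel₀ _ ht.ne']
        _ ≤ _ := by gcongr
    · refine setLIntegral_mono' measurableSet_Ioi fun s hs => ?_
      have hs0 : 0 ≤ s ^ (θ - 1) := Real.rpow_nonneg (ht.trans hs).le _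
      gcongr
      · nlinarith
      · exact min_le_right _ _
  -- `A` bounds the potential of the truncation `min g l` everywhere; `a` is the level that the
  -- potential of the excess `g - l` surpasses only on a set of measure at most `t`
  set A := K * (C * I) with hA
  set a := K * (C * (ENNReal.ofReal (t ^ (θ - 1)) * P)) with ha
  have key : decRearr w B (ENNReal.ofReal t) ≤ A + a := by
    refine le_of_forall_gt_imp_ge_of_dense fun α hα => ?_
    refine sInf_le ⟨bot_lt_of_lt hα, ?_⟩
    by_contra! hlarge
    have hαA : a < α - A := lt_tsub_iff_left.2 hα
    -- the potential of the part of `g` above the level `l`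
    set J : EuclideanSpace ℝ (Fin n) → ℝ≥0∞ := fun x => ∫⁻ y, rieszKernel (x - y) * (g y - l) ∂μ
      with hJ
    have hJm : Measurable J := by
      refine Measurable.lintegral_prod_right' (f := fun q : EuclideanSpace ℝ (Fin n) × _ =>
        rieszKernel (q.1 - q.2) * (g q.2 - l)) ?_
      exact (measurable_rieszKernel.comp (measurable_fst.sub measurable_snd)).mul
        ((hg.comp measurable_snd).sub_const _)
    set T := {x | α - A ≤ K * J x} with hT
    have hTm : MeasurableSet T := measurableSet_le measurable_const (hJm.const_mul _)
    have hwT : distribFun w B α ≤ μ T := by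
      have : distribFun w B α = μ {x | α < ‖w x‖ₑ} := by
        rw [hμ, Measure.restrict_apply' hB, inter_comm]
        rfl
      rw [this]
      apply measure_mono_ae
      filter_upwards [hw] with x hx hαx
      change α - A ≤ K * J x
      rw [tsub_le_iff_left]
      have h1 : ∫⁻ y, rieszKernel (x - y) * ‖G y‖ₑ ∂μ ≤ C * I + J x := by
        calc ∫⁻ y, rieszKernel (x - y) * ‖G y‖ₑ ∂μ
            = ∫⁻ y, rieszKernel (x - y) * g y ∂μ := by
              apply lintegral_congr_ae
              filter_upwards [hGg] with y hy
              rw [← hy]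
          _ = ∫⁻ y, (rieszKernel (x - y) * min (g y) l + rieszKernel (x - y) * (g y - l)) ∂μ := by
              refine lintegral_congr fun y => ?_
              rw [← mul_add, add_comm, tsub_add_min]
          _ = ∫⁻ y, rieszKernel (x - y) * min (g y) l ∂μ + J x := by
              rw [lintegral_add_left]
              exact (measurable_rieszKernel.comp (measurable_const.sub measurable_id)).mul
                (hg.min measurable_const)
          _ ≤ C * I + J x := by
              gcongr
              exact lintegral_mul_min_le_of_superlevel μ hg
                (measurable_rieszKernel.comp (measurable_const.sub measurable_id)) hRanti hsuper
                hθ0 (fun A => hCμ A x) l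
      have hαx' : α < ‖w x‖ₑ := hαx
      calc α ≤ ‖w x‖ₑ := hαx'.le
        _ ≤ K * (C * I + J x) := hx.trans (by gcongr)
        _ = A + K * J x := by rw [mul_add]
    have hm : ENNReal.ofReal t < μ T := hlarge.trans_le hwT
    have hweak : (α - A) * μ T ≤ K * (C * μ T ^ θ * P) := by
      calc (α - A) * μ T ≤ C * μ T ^ θ * ∫⁻ y, K * (g y - l) ∂μ := by
            refine mul_measure_le_of_le_rieszKernel hCμ ((hg.sub_const l).const_mul _) hTm
              fun x hx => ?_
            refine (mem_ofPred_eq.mp hx).trans_eq ?_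
            rw [hJ, ← lintegral_const_mul' _ _ ENNReal.coe_ne_top]
            refine lintegral_congr fun y => ?_
            ring
        _ = C * μ T ^ θ * (K * ∫⁻ y, (g y - l) ∂μ) := by
            rw [lintegral_const_mul' _ _ ENNReal.coe_ne_top]
        _ ≤ C * μ T ^ θ * (K * P) := by
            gcongr
            exact lintegral_tsub_le_of_superlevel μ hg hRanti hsuper ht.le hlt
        _ = _ := by ring
    have hm0 : μ T ≠ 0 := (bot_lt_of_lt hm).ne'
    have hmt : μ T ≠ ⊤ := measure_ne_top _ _
    have hcmp : K * (C * μ T ^ θ * P) ≤ a * μ T := by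
      have h1 : ENNReal.ofReal (t ^ (θ - 1)) * ENNReal.ofReal (t ^ (1 - θ)) = 1 := by
        rw [← ENNReal.ofReal_mul htθ.le, ← Real.rpow_add ht]
        simp
      have h2 : ENNReal.ofReal (t ^ (1 - θ)) ≤ μ T ^ (1 - θ) := by
        rw [← ENNReal.ofReal_rpow_of_pos ht]
        exact ENNReal.rpow_le_rpow hm.le (by linarith)
      have h3 : μ T ^ (1 - θ) * μ T ^ θ = μ T := by
        rw [← ENNReal.rpow_add _ _ hm0 hmt]
        simp
      calc K * (C * μ T ^ θ * P)
          = K * (C * (ENNReal.ofReal (t ^ (θ - 1)) * P)) *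
              (ENNReal.ofReal (t ^ (1 - θ)) * μ T ^ θ) := by
            rw [← mul_one (K * (C * μ T ^ θ * P)), ← h1]
            generalize ENNReal.ofReal (t ^ (θ - 1)) = u
            generalize ENNReal.ofReal (t ^ (1 - θ)) = v
            ring
        _ ≤ a * (μ T ^ (1 - θ) * μ T ^ θ) := by
            rw [← ha]
            gcongr
        _ = a * μ T := by rw [h3]
    have hstrict : a * μ T < (α - A) * μ T := (ENNReal.mul_lt_mul_iff_left hm0 hmt).2 hαA
    exact absurd (hweak.trans hcmp) (not_le.2 hstrict)
  calc decRearr w B (ENNReal.ofReal t) ≤ A + a := key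
    _ ≤ K * (C * (ENNReal.ofReal (t ^ (θ - 1)) * P + Q)) +
        K * (C * (ENNReal.ofReal (t ^ (θ - 1)) * P + Q)) := by
        rw [hA, ha]
        gcongr
        exact le_self_add
    _ = _ := by
        push_cast
        ring

/-! ### Hardy's inequality and Lorentz norms -/

theorem lintegral_Ioi_comp_mul_right {F : ℝ → ℝ≥0∞} (hF : Measurable F) {u : ℝ} (hu : 0 < u) :
    ∫⁻ t in Ioi (0 : ℝ), F (t * u) = ENNReal.ofReal u⁻¹ * ∫⁻ t in Ioi (0 : ℝ), F t := by
  rw [← lintegral_indicator measurableSet_Ioi, ← lintegral_indicator measurableSet_Ioi]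
  have h1 : ∀ t, (Ioi (0 : ℝ)).indicator (fun t => F (t * u)) t
      = (Ioi (0 : ℝ)).indicator F (t * u) := by
    intro t
    simp [indicator, hu]
  simp_rw [h1]
  rw [← lintegral_map (f := (Ioi (0 : ℝ)).indicator F) (g := fun t => t * u)
      (hF.indicator measurableSet_Ioi) (measurable_mul_const u),
    Real.map_volume_mul_right hu.ne', lintegral_smul_measure, abs_of_pos (inv_pos.2 hu), smul_eq_mul]

/-- The measure `dt / t` on the positive half-line is invariant under dilations. -/
theorem lintegral_Ioi_comp_mul_right_div {F : ℝ → ℝ≥0∞} (hF : Measurable F) {u : ℝ} (hu : 0 < u) :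
    ∫⁻ t in Ioi (0 : ℝ), F (t * u) / ENNReal.ofReal t
      = ∫⁻ t in Ioi (0 : ℝ), F t / ENNReal.ofReal t := by
  have h1 : ∀ t ∈ Ioi (0 : ℝ), F (t * u) / ENNReal.ofReal t
      = ENNReal.ofReal u * (F (t * u) / ENNReal.ofReal (t * u)) := by
    intro t ht
    have ht' : (0 : ℝ) < t := ht
    rw [mul_comm t u, ENNReal.ofReal_mul hu.le, ← mul_div_assoc,
      ENNReal.mul_div_mul_left _ _ (by simpa using hu) ENNReal.ofReal_ne_top]
  rw [setLIntegral_congr_fun measurableSet_Ioi h1, lintegral_const_mul' _ _ ENNReal.ofReal_ne_top,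
    lintegral_Ioi_comp_mul_right (F := fun t => F t / ENNReal.ofReal t) (by fun_prop) hu, ← mul_assoc,
    ← ENNReal.ofReal_mul hu.le, mul_inv_cancel₀ hu.ne', ENNReal.ofReal_one, one_mul]

/-- Jensen's inequality for the power `q` and the measure with density `k`. -/
theorem lintegral_mul_rpow_le {X : Type*} [MeasurableSpace X] (μ : Measure X) {k F : X → ℝ≥0∞}
    (hk : Measurable k) (hF : Measurable F) {q : ℝ} (hq : 1 ≤ q) :
    (∫⁻ x, k x * F x ∂μ) ^ q ≤ (∫⁻ x, k x ∂μ) ^ (q - 1) * ∫⁻ x, k x * F x ^ q ∂μ := by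
  have hq0 : 0 < q := by linarith
  have h := eLpNorm'_le_eLpNorm'_mul_rpow_measure_univ (μ := μ.withDensity k) (f := F)
    one_pos hq hF.aestronglyMeasurable
  simp only [eLpNorm'_eq_lintegral_enorm, enorm_eq_self, ENNReal.rpow_one, div_one,
    withDensity_apply _ MeasurableSet.univ, Measure.restrict_univ] at h
  rw [lintegral_withDensity_eq_lintegral_mul _ hk hF,
    lintegral_withDensity_eq_lintegral_mul _ hk (hF.pow_const q)] at h
  refine (ENNReal.rpow_le_rpow h hq0.le).trans_eq ?_
  rw [ENNReal.mul_rpow_of_nonneg _ _ hq0.le, ← ENNReal.rpow_mul, ← ENNReal.rpow_mul,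
    one_div_mul_cancel hq0.ne', ENNReal.rpow_one, mul_comm]
  congr 2
  field_simp

/-- **Hardy's inequality** in multiplicative convolution form: averaging dilates of `h` with a
weight `k` of finite mass is bounded on `L^q(dt / t)`. -/
theorem lintegral_dilation_average_rpow_le {k h : ℝ → ℝ≥0∞} (hk : Measurable k) (hh : Measurable h)
    {q : ℝ} (hq : 1 ≤ q) :
    ∫⁻ t in Ioi (0 : ℝ), (∫⁻ u in Ioi (0 : ℝ), k u * h (t * u)) ^ q / ENNReal.ofReal t ≤
      (∫⁻ u in Ioi (0 : ℝ), k u) ^ q * ∫⁻ t in Ioi (0 : ℝ), h t ^ q / ENNReal.ofReal t := by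
  set M := ∫⁻ u in Ioi (0 : ℝ), k u with hM
  calc ∫⁻ t in Ioi (0 : ℝ), (∫⁻ u in Ioi (0 : ℝ), k u * h (t * u)) ^ q / ENNReal.ofReal t
      ≤ ∫⁻ t in Ioi (0 : ℝ), M ^ (q - 1) *
          ∫⁻ u in Ioi (0 : ℝ), k u * (h (t * u) ^ q / ENNReal.ofReal t) := by
        refine lintegral_mono fun t => ?_
        have h1 : ∀ u, k u * (h (t * u) ^ q / ENNReal.ofReal t)
            = k u * h (t * u) ^ q * (ENNReal.ofReal t)⁻¹ := fun u => by
          rw [div_eq_mul_inv, mul_assoc]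
        simp_rw [h1]
        rw [lintegral_mul_const _ (by fun_prop), ← mul_assoc, ← div_eq_mul_inv]
        gcongr
        exact lintegral_mul_rpow_le _ hk (by fun_prop) hq
    _ = M ^ (q - 1) * ∫⁻ t in Ioi (0 : ℝ), ∫⁻ u in Ioi (0 : ℝ),
          k u * (h (t * u) ^ q / ENNReal.ofReal t) := by
        rw [lintegral_const_mul]
        refine Measurable.lintegral_prod_right' (f := fun p : ℝ × ℝ =>
          k p.2 * (h (p.1 * p.2) ^ q / ENNReal.ofReal p.1)) ?_
        fun_prop
    _ = M ^ (q - 1) * ∫⁻ u in Ioi (0 : ℝ), k u * ∫⁻ t in Ioi (0 : ℝ), h t ^ q / ENNReal.ofReal t := by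
        rw [lintegral_lintegral_swap (by fun_prop)]
        congr 1
        refine setLIntegral_congr_fun measurableSet_Ioi fun u hu => ?_
        rw [lintegral_const_mul _ (by fun_prop),
          lintegral_Ioi_comp_mul_right_div (F := fun t => h t ^ q) (by fun_prop) hu]
    _ = _ := by
        rw [lintegral_mul_const _ hk, ← mul_assoc]
        congr 1
        conv_rhs => rw [← sub_add_cancel q 1, ENNReal.rpow_add_of_nonneg _ _ (by linarith) one_pos.le,
          ENNReal.rpow_one]

/-- The weight on `(0, ∞)` that turns O'Neil's inequality into an average of dilates: the exponent
`θ` is the reciprocal of the dimension, and `r` the reciprocal of the integrability exponent. -/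
noncomputable def hardyWeight (θ r u : ℝ) : ℝ≥0∞ :=
  if u ≤ 1 then ENNReal.ofReal (u ^ (-r)) else ENNReal.ofReal (u ^ (θ - 1 - r))

theorem measurable_hardyWeight (θ r : ℝ) : Measurable (hardyWeight θ r) :=
  Measurable.ite measurableSet_Iic (by fun_prop) (by fun_prop)

theorem lintegral_hardyWeight_ne_top {θ r : ℝ} (hr : r < 1) (hθr : θ < r) :
    ∫⁻ u in Ioi (0 : ℝ), hardyWeight θ r u ≠ ⊤ := by
  rw [← Ioc_union_Ioi_eq_Ioi zero_le_one]
  refine ne_top_of_le_ne_top ?_ (lintegral_union_le _ _ _)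
  have h1 : ∫⁻ u in Ioc (0 : ℝ) 1, hardyWeight θ r u
      = ∫⁻ u in Ioc (0 : ℝ) 1, ENNReal.ofReal (u ^ (-r)) :=
    setLIntegral_congr_fun measurableSet_Ioc fun u hu => if_pos hu.2
  have h2 : ∫⁻ u in Ioi (1 : ℝ), hardyWeight θ r u
      = ∫⁻ u in Ioi (1 : ℝ), ENNReal.ofReal (u ^ (θ - 1 - r)) :=
    setLIntegral_congr_fun measurableSet_Ioi fun u hu => if_neg (not_le.2 hu)
  rw [h1, h2, lintegral_ofReal_rpow_Ioc (by linarith) zero_le_one,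
    lintegral_ofReal_rpow_Ioi (by linarith) one_pos]
  exact ENNReal.add_ne_top.2 ⟨ENNReal.ofReal_ne_top, ENNReal.ofReal_ne_top⟩

/-- The substitution `s = t * u` turns the right-hand side of O'Neil's inequality, multiplied by
`t ^ (r - θ)`, into an average of dilates of `s ↦ s ^ r * R s`. -/
theorem ofReal_rpow_mul_oneil_eq_dilation_average (θ r : ℝ) {R : ℝ → ℝ≥0∞} (hR : Measurable R)
    {t : ℝ} (ht : 0 < t) :
    ENNReal.ofReal t ^ (r - θ) * (ENNReal.ofReal (t ^ (θ - 1)) * (∫⁻ s in Ioc 0 t, R s) +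
        ∫⁻ s in Ioi t, ENNReal.ofReal (s ^ (θ - 1)) * R s)
      = ∫⁻ u in Ioi (0 : ℝ), hardyWeight θ r u * (ENNReal.ofReal (t * u) ^ r * R (t * u)) := by
  have hk := measurable_hardyWeight θ r
  have h0 := lintegral_Ioi_comp_mul_right
    (F := fun s => hardyWeight θ r (s / t) * (ENNReal.ofReal s ^ r * R s)) (by fun_prop) ht
  simp only [mul_div_cancel_right₀ _ ht.ne'] at h0
  simp_rw [mul_comm t]
  rw [h0, ← Ioc_union_Ioi_eq_Ioi ht.le, lintegral_union measurableSet_Ioi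
    (by rw [disjoint_left]; intro x hx hx'; exact absurd hx.2 (not_le.2 hx')), mul_add, mul_add]
  rw [ENNReal.ofReal_rpow_of_pos ht]
  congr 1
  · rw [← mul_assoc, ← ENNReal.ofReal_mul (Real.rpow_nonneg ht.le _), ← lintegral_const_mul _ hR,
      ← lintegral_const_mul _ (by fun_prop)]
    refine setLIntegral_congr_fun measurableSet_Ioc fun s hs => ?_
    have hs0 : 0 < s := hs.1
    rw [hardyWeight, if_pos ((div_le_one ht).2 hs.2), ENNReal.ofReal_rpow_of_pos hs0, ← mul_assoc,
      ← mul_assoc, ← ENNReal.ofReal_mul (by positivity), ← ENNReal.ofReal_mul (by positivity)]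
    congr 2
    rw [Real.div_rpow hs0.le ht.le, Real.rpow_neg hs0.le, Real.rpow_neg ht.le, ← Real.rpow_add ht,
      show r - θ + (θ - 1) = r - 1 by ring, Real.rpow_sub_one ht.ne']
    have := Real.rpow_pos_of_pos hs0 r
    have := Real.rpow_pos_of_pos ht r
    field_simp
  · rw [← lintegral_const_mul _ (by fun_prop), ← lintegral_const_mul _ (by fun_prop)]
    refine setLIntegral_congr_fun measurableSet_Ioi fun s hs => ?_
    have hs0 : 0 < s := ht.trans hs
    rw [hardyWeight, if_neg (not_le.2 ((one_lt_div ht).2 hs)), ENNReal.ofReal_rpow_of_pos hs0,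
      ← mul_assoc, ← mul_assoc, ← mul_assoc, ← ENNReal.ofReal_mul (by positivity),
      ← ENNReal.ofReal_mul (by positivity), ← ENNReal.ofReal_mul (by positivity)]
    congr 2
    rw [Real.div_rpow hs0.le ht.le, Real.rpow_sub hs0 (θ - 1), Real.rpow_sub ht (θ - 1),
      Real.rpow_sub ht r, Real.rpow_sub_one ht.ne']
    have := Real.rpow_pos_of_pos hs0 r
    have := Real.rpow_pos_of_pos ht r
    have := Real.rpow_pos_of_pos ht θ
    field_simp

/-- Functions whose decreasing rearrangements are related by O'Neil's inequality have comparable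
Lorentz norms, with the exponents of the Sobolev embedding. -/
theorem lorentzNorm_le_of_decRearr_le {n : ℕ} {F F' : Type*}
    [NormedAddCommGroup F] [NormedAddCommGroup F'] {p : ℝ} {q : ℝ≥0∞} (hp : 1 < p)
    (hpn : p < (n : ℝ)) (hq : 1 ≤ q) (M : ℝ≥0)
    {B : Set (EuclideanSpace ℝ (Fin n))}
    {w : EuclideanSpace ℝ (Fin n) → F} {G : EuclideanSpace ℝ (Fin n) → F'}
    (h : ∀ t : ℝ, 0 < t → decRearr w B (ENNReal.ofReal t) ≤ M *
      (ENNReal.ofReal (t ^ (1 / n - 1 : ℝ)) * (∫⁻ s in Ioc 0 t, decRearr G B (ENNReal.ofReal s)) +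
        ∫⁻ s in Ioi t, ENNReal.ofReal (s ^ (1 / n - 1 : ℝ)) * decRearr G B (ENNReal.ofReal s))) :
    lorentzNorm w (ENNReal.ofReal (p * n / (n - p))) q B ≤
      (M * (∫⁻ u in Ioi (0 : ℝ), hardyWeight (1 / n) p⁻¹ u)) * lorentzNorm G (ENNReal.ofReal p) q B := by
  have hp0 : 0 < p := by linarith
  have hn0 : (0 : ℝ) < n := by linarith
  set θ : ℝ := 1 / n with hθ
  have hexp1 : ((ENNReal.ofReal p)⁻¹).toReal = p⁻¹ := by
    rw [ENNReal.toReal_inv, ENNReal.toReal_ofReal hp0.le]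
  have hexp2 : ((ENNReal.ofReal (p * n / (n - p)))⁻¹).toReal = p⁻¹ - θ := by
    have : (0 : ℝ) < n - p := by linarith
    rw [ENNReal.toReal_inv, ENNReal.toReal_ofReal (by positivity), hθ]
    field_simp
  set R : ℝ → ℝ≥0∞ := fun s => decRearr G B (ENNReal.ofReal s) with hR
  have hRm : Measurable R := (decRearr_antitone G B).measurable.comp ENNReal.measurable_ofReal
  have hk := measurable_hardyWeight θ p⁻¹
  set k := hardyWeight θ p⁻¹
  set H : ℝ → ℝ≥0∞ := fun s => ENNReal.ofReal s ^ p⁻¹ * R s with hH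
  have hHm : Measurable H := by fun_prop
  have hpt : ∀ t : ℝ, 0 < t → ENNReal.ofReal t ^ (p⁻¹ - θ) * decRearr w B (ENNReal.ofReal t) ≤
      M * ∫⁻ u in Ioi (0 : ℝ), k u * H (t * u) := by
    intro t ht
    rw [← ofReal_rpow_mul_oneil_eq_dilation_average θ p⁻¹ hRm ht, mul_left_comm]
    gcongr
    exact h t ht
  unfold lorentzNorm
  rw [hexp1, hexp2]
  split_ifs with hqt
  · refine iSup₂_le fun t ht => (hpt t ht).trans ?_
    rw [mul_assoc, ← lintegral_mul_const _ hk]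
    refine mul_le_mul' le_rfl (setLIntegral_mono' measurableSet_Ioi fun u hu => ?_)
    refine mul_le_mul' le_rfl ?_
    exact le_iSup₂_of_le (t * u) (mul_pos ht hu) le_rfl
  · have hq1 : 1 ≤ q.toReal := by
      rw [← ENNReal.toReal_one]
      exact ENNReal.toReal_mono hqt hq
    have hq0 : 0 < q.toReal := by linarith
    calc _ ≤ (∫⁻ t in Ioi (0 : ℝ), (M : ℝ≥0∞) ^ q.toReal *
            ((∫⁻ u in Ioi (0 : ℝ), k u * H (t * u)) ^ q.toReal / ENNReal.ofReal t)) ^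
              (q.toReal)⁻¹ := by
          refine ENNReal.rpow_le_rpow ?_ (by positivity)
          refine setLIntegral_mono' measurableSet_Ioi fun t ht => ?_
          rw [← mul_div_assoc, ← ENNReal.mul_rpow_of_nonneg _ _ hq0.le]
          exact ENNReal.div_le_div_right (ENNReal.rpow_le_rpow (hpt t ht) hq0.le) _
      _ ≤ ((M : ℝ≥0∞) ^ q.toReal * ((∫⁻ u in Ioi (0 : ℝ), k u) ^ q.toReal *
            ∫⁻ t in Ioi (0 : ℝ), H t ^ q.toReal / ENNReal.ofReal t)) ^ (q.toReal)⁻¹ := by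
          rw [lintegral_const_mul' _ _ (by simp [hq0.le])]
          gcongr
          exact lintegral_dilation_average_rpow_le hk hHm hq1
      _ = _ := by
          rw [← mul_assoc, ← ENNReal.mul_rpow_of_nonneg _ _ hq0.le,
            ENNReal.mul_rpow_of_nonneg _ _ (by positivity), ← ENNReal.rpow_mul,
            mul_inv_cancel₀ hq0.ne', ENNReal.rpow_one]

/-! ### The potential estimate for smooth functions -/

theorem lintegral_comp_homothety {n : ℕ} {F : EuclideanSpace ℝ (Fin n) → ℝ≥0∞} (hF : Measurable F)
    (x : EuclideanSpace ℝ (Fin n)) {s : ℝ} (hs : 0 < s) :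
    ∫⁻ y, F (x + s • (y - x)) = ENNReal.ofReal (s ^ (-n : ℝ)) * ∫⁻ z, F z := by
  rw [lintegral_sub_right_eq_self (fun y => F (x + s • y)) x,
    ← lintegral_map (f := fun z => F (x + z)) (g := fun y => s • y) (by fun_prop) (by fun_prop),
    Measure.map_addHaar_smul _ hs.ne', lintegral_smul_measure, lintegral_add_left_eq_self,
    finrank_euclideanSpace_fin, abs_of_pos (by positivity), Real.rpow_neg hs.le, Real.rpow_natCast,
    smul_eq_mul]

theorem enorm_sub_le_lintegral_fderiv {E : Type*} [NormedAddCommGroup E] [NormedSpace ℝ E]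
    {u : E → ℝ} (hu : ContDiff ℝ 1 u) (x y : E) :
    ‖u x - u y‖ₑ ≤ ∫⁻ s in Ioc (0 : ℝ) 1, ‖fderiv ℝ u (x + s • (y - x))‖ₑ * ‖y - x‖ₑ := by
  have hd : ∀ s : ℝ, HasDerivAt (fun s : ℝ => u (x + s • (y - x)))
      (fderiv ℝ u (x + s • (y - x)) (y - x)) s := by
    intro s
    have h1 : HasDerivAt (fun s : ℝ => x + s • (y - x)) (y - x) s := by
      simpa using ((hasDerivAt_id s).smul_const (y - x)).const_add x
    exact ((hu.differentiable one_ne_zero _).hasFDerivAt).comp_hasDerivAt s h1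
  have hc : Continuous fun s : ℝ => fderiv ℝ u (x + s • (y - x)) (y - x) :=
    ((hu.continuous_fderiv one_ne_zero).comp (by fun_prop)).clm_apply continuous_const
  have hint := intervalIntegral.integral_eq_sub_of_hasDerivAt (a := 0) (b := 1)
    (fun s _ => hd s) (hc.intervalIntegrable _ _)
  simp only [one_smul, zero_smul, add_zero, add_sub_cancel] at hint
  rw [← enorm_neg, neg_sub, ← hint, intervalIntegral.integral_of_le zero_le_one]
  exact (enorm_integral_le_lintegral_enorm _).trans
    (lintegral_mono fun s => ContinuousLinearMap.le_opENorm _ _)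

/-- The weight that a point at displacement `z` from the base point receives when the segments from
the base point to the points of a ball of radius `r` are collected. -/
theorem lintegral_segment_weight_le {n : ℕ} (hn : 2 ≤ n) (z : EuclideanSpace ℝ (Fin n)) {r : ℝ}
    (hr : 0 < r) :
    ∫⁻ s in Ioc (0 : ℝ) 1, ENNReal.ofReal (s ^ (-n : ℝ)) *
        ((Ioi (‖z‖ / (2 * r))).indicator 1 s * ENNReal.ofReal (‖z‖ / s)) ≤
      ENNReal.ofReal ((2 * r) ^ n / n) * rieszKernel z := by
  have hn' : (2 : ℝ) ≤ n := by exact_mod_cast hn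
  rcases eq_or_ne z 0 with rfl | hz
  · simp
  have hz' : 0 < ‖z‖ := norm_pos_iff.2 hz
  set c := ‖z‖ / (2 * r) with hc
  have hc0 : 0 < c := by positivity
  calc _ ≤ ∫⁻ s in Ioi (0 : ℝ), (Ioi c).indicator
          (fun s => ENNReal.ofReal ‖z‖ * ENNReal.ofReal (s ^ (-n - 1 : ℝ))) s := by
        refine (lintegral_mono_set Ioc_subset_Ioi_self).trans
          (setLIntegral_mono' measurableSet_Ioi fun s hs => ?_)
        have hs0 : 0 < s := hs
        by_cases h : s ∈ Ioi c
        · rw [indicator_of_mem h, indicator_of_mem h, Pi.one_apply, one_mul,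
            ← ENNReal.ofReal_mul (by positivity), ← ENNReal.ofReal_mul (by positivity),
            Real.rpow_sub_one hs0.ne']
          apply le_of_eq
          congr 1
          ring
        · rw [indicator_of_notMem h, indicator_of_notMem h]
          simp
    _ = ENNReal.ofReal ((2 * r) ^ n / n) * rieszKernel z := by
        rw [lintegral_indicator measurableSet_Ioi, Measure.restrict_restrict measurableSet_Ioi,
          inter_eq_left.2 (Ioi_subset_Ioi hc0.le), lintegral_const_mul _ (by fun_prop),
          lintegral_ofReal_rpow_Ioi (by linarith) hc0, rieszKernel,
          ← ENNReal.ofReal_mul (by positivity), ← ENNReal.ofReal_mul (by positivity)]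
        congr 1
        have h1 : (-n - 1 + 1 : ℝ) = -n := by ring
        rw [h1, hc, Real.rpow_neg (by positivity), Real.rpow_natCast, div_pow,
          Real.rpow_sub hz', Real.rpow_one, Real.rpow_natCast]
        field_simp

/-- On a ball, the mean oscillation of a `C¹` function about one of its values is controlled by the
Riesz potential of its gradient. -/
theorem lintegral_enorm_sub_le_of_contDiff {n : ℕ} (hn : 2 ≤ n)
    {u : EuclideanSpace ℝ (Fin n) → ℝ} (hu : ContDiff ℝ 1 u) {r : ℝ}
    {x : EuclideanSpace ℝ (Fin n)} (hx : x ∈ ball 0 r) :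
    ∫⁻ y in ball 0 r, ‖u x - u y‖ₑ ≤ ENNReal.ofReal ((2 * r) ^ n / n) *
      ∫⁻ z in ball 0 r, rieszKernel (x - z) * ‖fderiv ℝ u z‖ₑ := by
  have hr : 0 < r := pos_of_mem_ball hx
  have hcont : Continuous (fderiv ℝ u) := hu.continuous_fderiv one_ne_zero
  have hm : Measurable fun z => ‖fderiv ℝ u z‖ₑ := hcont.enorm.measurable
  -- integrand after the substitution `z = x + s • (y - x)`
  obtain ⟨F, hF⟩ : ∃ F : ℝ → EuclideanSpace ℝ (Fin n) → ℝ≥0∞, F = fun s z =>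
    (Ioi (‖x - z‖ / (2 * r))).indicator 1 s * ENNReal.ofReal (‖x - z‖ / s) *
      (ball (0 : EuclideanSpace ℝ (Fin n)) r).indicator (fun z => ‖fderiv ℝ u z‖ₑ) z := ⟨_, rfl⟩
  have hFm : Measurable (Function.uncurry F) := by
    rw [hF]
    refine Measurable.mul (Measurable.mul ?_ (by fun_prop)) ?_
    · exact measurable_one.indicator
        (s := {q : ℝ × EuclideanSpace ℝ (Fin n) | ‖x - q.2‖ / (2 * r) < q.1})
        (measurableSet_lt (by fun_prop) (by fun_prop))
    · exact (hm.indicator measurableSet_ball).comp measurable_snd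
  calc ∫⁻ y in ball 0 r, ‖u x - u y‖ₑ
      ≤ ∫⁻ y in ball 0 r, ∫⁻ s in Ioc (0 : ℝ) 1,
          ‖fderiv ℝ u (x + s • (y - x))‖ₑ * ‖y - x‖ₑ :=
        lintegral_mono fun y => enorm_sub_le_lintegral_fderiv hu x y
    _ = ∫⁻ s in Ioc (0 : ℝ) 1, ∫⁻ y in ball 0 r,
          ‖fderiv ℝ u (x + s • (y - x))‖ₑ * ‖y - x‖ₑ := by
        apply lintegral_lintegral_swap
        refine Measurable.aemeasurable (Measurable.mul ?_
          (measurable_fst.sub measurable_const).enorm)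
        exact hm.comp (g := fun z => ‖fderiv ℝ u z‖ₑ) (f := fun q : EuclideanSpace ℝ (Fin n) × ℝ =>
          x + q.2 • (q.1 - x)) (by fun_prop)
    _ ≤ ∫⁻ s in Ioc (0 : ℝ) 1, ENNReal.ofReal (s ^ (-n : ℝ)) * ∫⁻ z, F s z := by
        refine setLIntegral_mono' measurableSet_Ioc fun s hs => ?_
        have hs0 : 0 < s := hs.1
        have hFs : Measurable (F s) := hFm.comp measurable_prodMk_left
        rw [← lintegral_comp_homothety hFs x hs0]
        refine (setLIntegral_mono' measurableSet_ball fun y hy => ?_).trans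
          (setLIntegral_le_lintegral (ball 0 r) _)
        have hmem : x + s • (y - x) ∈ ball (0 : EuclideanSpace ℝ (Fin n)) r := by
          have := (convex_ball (0 : EuclideanSpace ℝ (Fin n)) r).add_smul_sub_mem hx hy
            ⟨hs0.le, hs.2⟩
          exact this
        have hnorm : ‖x - (x + s • (y - x))‖ = s * ‖y - x‖ := by
          rw [sub_add_cancel_left, norm_neg, norm_smul, Real.norm_of_nonneg hs0.le]
        have hlt : ‖y - x‖ < 2 * r := by
          have h1 := norm_sub_le y x
          have h2 := mem_ball_zero_iff.1 hx
          have h3 := mem_ball_zero_iff.1 hy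
          linarith
        have hs' : s ∈ Ioi (‖x - (x + s • (y - x))‖ / (2 * r)) := by
          rw [mem_Ioi, hnorm, div_lt_iff₀ (by positivity)]
          exact mul_lt_mul_of_pos_left hlt hs0
        simp only [hF]
        rw [indicator_of_mem hs', indicator_of_mem hmem, hnorm, mul_div_cancel_left₀ _ hs0.ne',
          ofReal_norm, Pi.one_apply, one_mul, mul_comm]
    _ = ∫⁻ s in Ioc (0 : ℝ) 1, ∫⁻ z, ENNReal.ofReal (s ^ (-n : ℝ)) * F s z := by
        refine lintegral_congr fun s => ?_
        rw [lintegral_const_mul' _ _ ENNReal.ofReal_ne_top]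
    _ = ∫⁻ z, ∫⁻ s in Ioc (0 : ℝ) 1, ENNReal.ofReal (s ^ (-n : ℝ)) * F s z := by
        apply lintegral_lintegral_swap
        exact (Measurable.mul (by fun_prop) hFm).aemeasurable
    _ ≤ ∫⁻ z, ENNReal.ofReal ((2 * r) ^ n / n) * (ball (0 : EuclideanSpace ℝ (Fin n)) r).indicator
          (fun z => rieszKernel (x - z) * ‖fderiv ℝ u z‖ₑ) z := by
        refine lintegral_mono fun z => ?_
        simp only [hF]
        by_cases hz : z ∈ ball (0 : EuclideanSpace ℝ (Fin n)) r
        · simp_rw [indicator_of_mem hz, ← mul_assoc]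
          rw [lintegral_mul_const' _ _ enorm_ne_top]
          gcongr
          refine le_of_eq_of_le ?_ (lintegral_segment_weight_le hn (x - z) hr)
          simp_rw [mul_assoc]
        · simp [indicator_of_notMem hz]
    _ = _ := by
        rw [lintegral_const_mul' _ _ ENNReal.ofReal_ne_top, lintegral_indicator measurableSet_ball]

/-! ### Mollification -/

/-- The gradient of a mollification is dominated by the mollification of the weak gradient, at
points whose distance to the complement exceeds the radius of the mollifier. -/
theorem HasWeakGradientOn.enorm_fderiv_convolution_le {n : ℕ}
    {f : EuclideanSpace ℝ (Fin n) → ℝ} {G : EuclideanSpace ℝ (Fin n) → EuclideanSpace ℝ (Fin n)}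
    {ρ : ℝ} (hf : IntegrableOn f (ball 0 ρ)) (hG : HasWeakGradientOn f G (ball 0 ρ))
    (φ : ContDiffBump (0 : EuclideanSpace ℝ (Fin n))) {x : EuclideanSpace ℝ (Fin n)} {r : ℝ}
    (hx : ball x φ.rOut ⊆ ball 0 r) (hr : r < ρ) :
    ‖fderiv ℝ (convolution ((ball 0 ρ).indicator f) (φ.normed volume)
        (ContinuousLinearMap.lsmul ℝ ℝ) volume) x‖ₑ ≤
      ∫⁻ y, (ball 0 r).indicator (fun y => ‖G y‖ₑ) y * ENNReal.ofReal (φ.normed volume (x - y)) := by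
  set ψ := φ.normed volume with hψ
  have hψc : HasCompactSupport ψ := φ.hasCompactSupport_normed
  have hψs : ContDiff ℝ ∞ ψ := φ.contDiff_normed
  have hψ1 : ContDiff ℝ 1 ψ := hψs.of_le (by exact_mod_cast le_top)
  have hF : LocallyIntegrable ((ball 0 ρ).indicator f) volume :=
    (integrable_indicator_iff measurableSet_ball).2 hf |>.locallyIntegrable
  rw [(hψc.hasFDerivAt_convolution_right (ContinuousLinearMap.lsmul ℝ ℝ) hF hψ1 x).fderiv]
  refine ContinuousLinearMap.opENorm_le_bound _ fun v => ?_
  rw [convolution_precompR_apply _ hF (hψc.fderiv ℝ) (hψ1.continuous_fderiv one_ne_zero),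
    convolution_def]
  -- the test function `y ↦ ψ (x - y)`
  set η : EuclideanSpace ℝ (Fin n) → ℝ := fun y => ψ (x - y) with hη
  have hηs : ContDiff ℝ ∞ η := hψs.comp (contDiff_const.sub contDiff_id)
  have hzero : ∀ y, y ∉ ball x φ.rOut → η y = 0 := by
    intro y hy
    rw [hη]
    have : x - y ∉ Function.support ψ := by
      rw [hψ, φ.support_normed_eq]
      simpa [dist_eq_norm, norm_sub_rev] using hy
    simpa using this
  have hsub : tsupport η ⊆ closedBall x φ.rOut := by
    refine closure_minimal (fun y hy => ?_) isClosed_closedBall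
    by_contra hcon
    exact hy (hzero y fun h => hcon (ball_subset_closedBall h))
  have hηc : HasCompactSupport η :=
    (isCompact_closedBall x φ.rOut).of_isClosed_subset (isClosed_tsupport η) hsub
  have hsub' : tsupport η ⊆ ball 0 ρ := by
    have h1 : closedBall x φ.rOut ⊆ closedBall 0 r := by
      rw [← closure_ball x φ.rOut_pos.ne']
      exact (closure_mono hx).trans closure_ball_subset_closedBall
    exact hsub.trans (h1.trans (closedBall_subset_ball hr))
  have hder : ∀ y, fderiv ℝ ψ (x - y) v = - fderiv ℝ η y v := by
    intro y
    have h1 : HasFDerivAt η ((fderiv ℝ ψ (x - y)).comp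
        (-ContinuousLinearMap.id ℝ (EuclideanSpace ℝ (Fin n)))) y := by
      have h2 : HasFDerivAt (fun y => x - y)
          (-ContinuousLinearMap.id ℝ (EuclideanSpace ℝ (Fin n))) y :=
        (hasFDerivAt_id y).const_sub x
      exact ((hψ1.differentiable one_ne_zero (x - y)).hasFDerivAt).comp y h2
    rw [h1.fderiv]
    simp
  have hint : ∫ t, (ContinuousLinearMap.lsmul ℝ ℝ) ((ball 0 ρ).indicator f t)
      (fderiv ℝ ψ (x - t) v) = ∫ y in ball 0 ρ, inner ℝ (G y) v * η y := by
    rw [← neg_neg (∫ y in ball 0 ρ, inner ℝ (G y) v * η y),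
      ← hG.integral_eq η hηs hηc hsub' v, ← integral_neg, ← integral_indicator measurableSet_ball]
    congr 1
    ext t
    by_cases ht : t ∈ ball (0 : EuclideanSpace ℝ (Fin n)) ρ
    · simp only [indicator_of_mem ht, ContinuousLinearMap.lsmul_apply, hder, smul_eq_mul, mul_neg]
    · simp only [indicator_of_notMem ht, map_zero, zero_apply]
  rw [hint]
  calc ‖∫ y in ball 0 ρ, inner ℝ (G y) v * η y‖ₑ
      ≤ ∫⁻ y in ball 0 ρ, ‖inner ℝ (G y) v * η y‖ₑ := enorm_integral_le_lintegral_enorm _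
    _ ≤ ∫⁻ y, ‖inner ℝ (G y) v * η y‖ₑ := setLIntegral_le_lintegral _ _
    _ ≤ ∫⁻ y, (ball 0 r).indicator (fun y => ‖G y‖ₑ) y * ENNReal.ofReal (η y) * ‖v‖ₑ := by
        refine lintegral_mono fun y => ?_
        by_cases hy : y ∈ ball x φ.rOut
        · rw [indicator_of_mem (hx hy), enorm_mul, Real.enorm_eq_ofReal (φ.nonneg_normed _)]
          have h1 : ‖(inner ℝ (G y) v : ℝ)‖ₑ ≤ ‖G y‖ₑ * ‖v‖ₑ := by
            rw [← ofReal_norm, ← ofReal_norm, ← ofReal_norm, ← ENNReal.ofReal_mul (norm_nonneg _)]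
            exact ENNReal.ofReal_le_ofReal (norm_inner_le_norm _ _)
          calc _ ≤ ‖G y‖ₑ * ‖v‖ₑ * ENNReal.ofReal (η y) := by gcongr
            _ = _ := by ring
        · simp [hzero y hy]
    _ = _ := lintegral_mul_const' _ _ enorm_ne_top

/-- A measurable, locally integrable extended nonnegative function is the almost everywhere limit of
its mollifications. -/
theorem ae_tendsto_lintegral_normed {n : ℕ} {J : EuclideanSpace ℝ (Fin n) → ℝ≥0∞}
    (hJ : Measurable J) (hJfin : ∀ R : ℝ, ∫⁻ x in ball 0 R, J x ≠ ⊤)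
    {φ : ℕ → ContDiffBump (0 : EuclideanSpace ℝ (Fin n))} {K : ℝ}
    (hφ : Filter.Tendsto (fun i => (φ i).rOut) Filter.atTop (nhds 0))
    (hK : ∀ i, (φ i).rOut ≤ K * (φ i).rIn) :
    ∀ᵐ x, Filter.Tendsto (fun i => ∫⁻ y, ENNReal.ofReal ((φ i).normed volume y) * J (x - y))
      Filter.atTop (nhds (J x)) := by
  have hball : ∀ᵐ x, J x < ⊤ := by
    have h1 : ∀ k : ℕ, ∀ᵐ x ∂volume.restrict (ball (0 : EuclideanSpace ℝ (Fin n)) k), J x < ⊤ :=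
      fun k => ae_lt_top hJ (hJfin k)
    have h2 := ae_all_iff.2 fun k => (ae_restrict_iff' measurableSet_ball).1 (h1 k)
    filter_upwards [h2] with x hx
    obtain ⟨k, hk⟩ := exists_nat_gt ‖x‖
    exact hx k (by simpa using hk)
  have hloc : LocallyIntegrable (fun x => (J x).toReal) volume := by
    rw [locallyIntegrable_iff]
    intro k hk
    obtain ⟨R, hR⟩ := hk.isBounded.subset_ball 0
    have : IntegrableOn (fun x => (J x).toReal) (ball 0 R) :=
      integrable_toReal_of_lintegral_ne_top hJ.aemeasurable (hJfin R)
    exact this.mono_set hR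
  have hconv := ContDiffBump.ae_convolution_tendsto_right_of_locallyIntegrable
    (μ := (volume : Measure (EuclideanSpace ℝ (Fin n)))) hφ (Filter.Eventually.of_forall hK) hloc
  filter_upwards [hconv, hball] with x hx hxfin
  have hlim := (ENNReal.continuous_ofReal.tendsto _).comp hx
  rw [ENNReal.ofReal_toReal hxfin.ne] at hlim
  refine hlim.congr fun i => ?_
  have hae : ∀ᵐ y, J (x - y) < ⊤ :=
    (quasiMeasurePreserving_sub_left volume x).ae hball
  simp only [Function.comp]
  rw [convolution_def, ofReal_integral_eq_lintegral_ofReal]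
  · apply lintegral_congr_ae
    filter_upwards [hae] with y hy
    rw [ContinuousLinearMap.lsmul_apply, smul_eq_mul, ENNReal.ofReal_mul ((φ i).nonneg_normed _),
      ENNReal.ofReal_toReal hy.ne]
  · exact ((φ i).hasCompactSupport_normed.convolutionExists_left (ContinuousLinearMap.lsmul ℝ ℝ)
      (φ i).continuous_normed hloc x)
  · exact Filter.Eventually.of_forall fun y =>
      mul_nonneg ((φ i).nonneg_normed _) ENNReal.toReal_nonneg

theorem lintegral_ball_rieszPotential_ne_top {n : ℕ} (hn : 2 ≤ n)
    {g : EuclideanSpace ℝ (Fin n) → ℝ≥0∞} (hg : Measurable g) (hgfin : ∫⁻ z, g z ≠ ⊤) (R : ℝ) :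
    ∫⁻ x in ball 0 R, rieszPotential g x ≠ ⊤ := by
  obtain ⟨C, -, hC⟩ := exists_lintegral_rieszKernel_le hn
  have h1 : ∫⁻ x in ball 0 R, rieszPotential g x
      ≤ ∫⁻ z, C * volume (ball (0 : EuclideanSpace ℝ (Fin n)) R) ^ (1 / n : ℝ) * g z := by
    unfold rieszPotential
    rw [lintegral_lintegral_swap (by fun_prop)]
    refine lintegral_mono fun z => ?_
    rw [lintegral_mul_const _ (by fun_prop)]
    gcongr
    simp_rw [fun x => rieszKernel_sub_comm x z]
    exact hC _ z
  refine ne_top_of_le_ne_top ?_ h1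
  rw [lintegral_const_mul _ hg]
  exact ENNReal.mul_ne_top (ENNReal.mul_ne_top ENNReal.coe_ne_top
    (ENNReal.rpow_ne_top_of_nonneg (by positivity) measure_ball_lt_top.ne)) hgfin

/-- The Riesz potential commutes with convolution. -/
theorem lintegral_rieszKernel_mul_lintegral_eq {n : ℕ}
    {g k : EuclideanSpace ℝ (Fin n) → ℝ≥0∞} (hg : Measurable g) (hk : Measurable k)
    (x : EuclideanSpace ℝ (Fin n)) :
    ∫⁻ z, rieszKernel (x - z) * ∫⁻ y, g y * k (z - y) = ∫⁻ y, k y * rieszPotential g (x - y) := by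
  have h1 : ∀ z, ∫⁻ y, g y * k (z - y) = ∫⁻ y, g (z - y) * k y := fun z => by
    rw [← lintegral_sub_left_eq_self (fun y => g y * k (z - y)) z]
    simp
  simp_rw [h1]
  have h2 : ∀ z, rieszKernel (x - z) * ∫⁻ y, g (z - y) * k y
      = ∫⁻ y, rieszKernel (x - z) * (g (z - y) * k y) := fun z => by
    rw [lintegral_const_mul _ (by fun_prop)]
  simp_rw [h2]
  rw [lintegral_lintegral_swap]
  · refine lintegral_congr fun y => ?_
    rw [rieszPotential, ← lintegral_const_mul _ (by fun_prop),
      ← lintegral_sub_right_eq_self (fun z => k y * (rieszKernel (x - y - z) * g z)) y]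
    refine lintegral_congr fun z => ?_
    rw [show x - y - (z - y) = x - z by abel]
    ring
  · refine Measurable.aemeasurable (Measurable.mul ?_ (Measurable.mul ?_ ?_))
    · exact measurable_rieszKernel.comp (measurable_const.sub measurable_fst)
    · exact hg.comp (measurable_fst.sub measurable_snd)
    · exact hk.comp measurable_snd

/-! ### The potential estimate for weakly differentiable functions -/

/-- The potential estimate on a strictly smaller ball, where the gradient is integrable and `f` can be
mollified; the constant does not degenerate as `r` tends to `ρ`. -/
theorem HasWeakGradientOn.ae_lintegral_enorm_sub_le_of_lt {n : ℕ} (hn : 2 ≤ n)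
    {f : EuclideanSpace ℝ (Fin n) → ℝ} {G : EuclideanSpace ℝ (Fin n) → EuclideanSpace ℝ (Fin n)}
    {ρ : ℝ} (hf : IntegrableOn f (ball 0 ρ)) (hG : HasWeakGradientOn f G (ball 0 ρ))
    {r : ℝ} (hrρ : r < ρ) :
    ∀ᵐ x, x ∈ ball (0 : EuclideanSpace ℝ (Fin n)) r → ∫⁻ y in ball 0 r, ‖f x - f y‖ₑ ≤
      ENNReal.ofReal ((2 * r) ^ n / n) * ∫⁻ z in ball 0 ρ, rieszKernel (x - z) * ‖G z‖ₑ := by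
  obtain ⟨r', hr', hr'ρ⟩ := exists_between hrρ
  have hGint : IntegrableOn G (ball 0 r') :=
    (hG.locallyIntegrableOn_grad.integrableOn_compact_subset (closedBall_subset_ball hr'ρ)
      (isCompact_closedBall 0 r')).mono_set ball_subset_closedBall
  have hGm : AEMeasurable ((ball 0 r').indicator fun z => ‖G z‖ₑ) volume :=
    (aemeasurable_indicator_iff measurableSet_ball).2 hGint.aestronglyMeasurable.enorm
  -- `g` is a Borel version of `|G|`, cut off to a ball between the two
  obtain ⟨g, hg, hGg⟩ := hGm
  have hgfin : ∫⁻ z, g z ≠ ⊤ := by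
    rw [← lintegral_congr_ae hGg, lintegral_indicator measurableSet_ball]
    exact hGint.2.ne
  have hpot : ∀ x, rieszPotential g x ≤ ∫⁻ z in ball 0 ρ, rieszKernel (x - z) * ‖G z‖ₑ := by
    intro x
    rw [rieszPotential, ← lintegral_indicator measurableSet_ball]
    apply lintegral_mono_ae
    filter_upwards [hGg] with z hz
    rw [← hz]
    by_cases hzr : z ∈ ball (0 : EuclideanSpace ℝ (Fin n)) r'
    · rw [indicator_of_mem hzr, indicator_of_mem (ball_subset_ball hr'ρ.le hzr)]
    · simp [indicator_of_notMem hzr]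
  set δ : ℕ → ℝ := fun i => (r' - r) / (i + 1) with hδ
  have hδ0 : ∀ i, 0 < δ i := fun i => div_pos (by linarith) (by positivity)
  have hδle : ∀ i, δ i ≤ r' - r := fun i =>
    div_le_self (by linarith) (by have : (0 : ℝ) ≤ i := i.cast_nonneg; linarith)
  have hδlim : Filter.Tendsto δ Filter.atTop (nhds 0) := by
    have := (tendsto_one_div_add_atTop_nhds_zero_nat (𝕜 := ℝ)).const_mul (r' - r)
    simpa [hδ, div_eq_mul_inv] using this
  set φ : ℕ → ContDiffBump (0 : EuclideanSpace ℝ (Fin n)) := fun i =>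
    ⟨δ i / 2, δ i, half_pos (hδ0 i), half_lt_self (hδ0 i)⟩ with hφ
  have hφlim : Filter.Tendsto (fun i => (φ i).rOut) Filter.atTop (nhds 0) := hδlim
  have hφK : ∀ i, (φ i).rOut ≤ 2 * (φ i).rIn := fun i => by
    simp only [hφ]
    linarith
  have hF : LocallyIntegrable ((ball 0 ρ).indicator f) volume :=
    (integrable_indicator_iff measurableSet_ball).2 hf |>.locallyIntegrable
  set u : ℕ → EuclideanSpace ℝ (Fin n) → ℝ := fun i => convolution ((ball 0 ρ).indicator f)
    ((φ i).normed volume) (ContinuousLinearMap.lsmul ℝ ℝ) volume with hu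
  have hus : ∀ i, ContDiff ℝ 1 (u i) := fun i =>
    (φ i).hasCompactSupport_normed.contDiff_convolution_right (n := 1)
      (ContinuousLinearMap.lsmul ℝ ℝ) hF (φ i).contDiff_normed
  have hulim : ∀ᵐ x, x ∈ ball (0 : EuclideanSpace ℝ (Fin n)) ρ →
      Filter.Tendsto (fun i => u i x) Filter.atTop (nhds (f x)) := by
    filter_upwards [ContDiffBump.ae_convolution_tendsto_right_of_locallyIntegrable
      (μ := (volume : Measure (EuclideanSpace ℝ (Fin n)))) hφlim
      (Filter.Eventually.of_forall hφK) hF] with x hx hxρ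
    rw [indicator_of_mem hxρ] at hx
    refine hx.congr fun i => ?_
    rw [convolution_lsmul_swap, hu]
    simp only [convolution_def, ContinuousLinearMap.lsmul_apply, smul_eq_mul]
    congr 1
    ext t
    ring
  have hbound : ∀ i, ∀ x ∈ ball (0 : EuclideanSpace ℝ (Fin n)) r,
      ∫⁻ y in ball 0 r, ‖u i x - u i y‖ₑ ≤ ENNReal.ofReal ((2 * r) ^ n / n) *
        ∫⁻ y, ENNReal.ofReal ((φ i).normed volume y) * rieszPotential g (x - y) := by
    intro i x hx
    have hψm : Measurable fun y => ENNReal.ofReal ((φ i).normed volume y) :=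
      (φ i).continuous_normed.measurable.ennreal_ofReal
    refine (lintegral_enorm_sub_le_of_contDiff hn (hus i) hx).trans (mul_le_mul' le_rfl ?_)
    rw [← lintegral_rieszKernel_mul_lintegral_eq hg hψm]
    refine (setLIntegral_mono' measurableSet_ball fun z hz => ?_).trans
      (setLIntegral_le_lintegral (ball 0 r) _)
    gcongr
    have hsub : ball z (φ i).rOut ⊆ ball 0 r' := by
      refine ball_subset_ball' ?_
      have h1 : dist z 0 < r := hz
      have h2 : (φ i).rOut ≤ r' - r := hδle i
      linarith
    refine (hG.enorm_fderiv_convolution_le hf (φ i) hsub hr'ρ).trans_eq ?_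
    apply lintegral_congr_ae
    filter_upwards [hGg] with y hy
    rw [hy]
  filter_upwards [hulim, ae_tendsto_lintegral_normed (measurable_rieszPotential hg)
    (lintegral_ball_rieszPotential_ne_top hn hg hgfin) hφlim hφK] with x hx hxJ hxr
  have hxρ := ball_subset_ball hrρ.le hxr
  calc ∫⁻ y in ball 0 r, ‖f x - f y‖ₑ
      = ∫⁻ y in ball 0 r, Filter.liminf (fun i => ‖u i x - u i y‖ₑ) Filter.atTop := by
        apply lintegral_congr_ae
        filter_upwards [ae_restrict_of_ae hulim, ae_restrict_mem measurableSet_ball] with y hy hyr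
        exact ((hx hxρ).sub (hy (ball_subset_ball hrρ.le hyr))).enorm.liminf_eq.symm
    _ ≤ Filter.liminf (fun i => ∫⁻ y in ball 0 r, ‖u i x - u i y‖ₑ) Filter.atTop :=
        lintegral_liminf_le fun i =>
          (measurable_const.sub (hus i).continuous.measurable).enorm
    _ ≤ Filter.liminf (fun i => ENNReal.ofReal ((2 * r) ^ n / n) *
          ∫⁻ y, ENNReal.ofReal ((φ i).normed volume y) * rieszPotential g (x - y))
            Filter.atTop :=
        Filter.liminf_le_liminf (Filter.Eventually.of_forall fun i => hbound i x hxr)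
    _ = ENNReal.ofReal ((2 * r) ^ n / n) * rieszPotential g x :=
        (ENNReal.Tendsto.const_mul hxJ (Or.inr ENNReal.ofReal_ne_top)).liminf_eq
    _ ≤ _ := by
        gcongr
        exact hpot x

/-- Almost everywhere on a ball, the oscillation of a function about its value at a point is
controlled by the Riesz potential of its weak gradient; the gradient need not be integrable up to
the boundary. -/
theorem HasWeakGradientOn.ae_lintegral_enorm_sub_le {n : ℕ} (hn : 2 ≤ n)
    {f : EuclideanSpace ℝ (Fin n) → ℝ} {G : EuclideanSpace ℝ (Fin n) → EuclideanSpace ℝ (Fin n)}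
    {ρ : ℝ} (hρ : 0 < ρ) (hf : IntegrableOn f (ball 0 ρ)) (hG : HasWeakGradientOn f G (ball 0 ρ)) :
    ∀ᵐ x, x ∈ ball (0 : EuclideanSpace ℝ (Fin n)) ρ → ∫⁻ y in ball 0 ρ, ‖f x - f y‖ₑ ≤
      ENNReal.ofReal ((2 * ρ) ^ n / n) * ∫⁻ z in ball 0 ρ, rieszKernel (x - z) * ‖G z‖ₑ := by
  set r : ℕ → ℝ := fun j => ρ - ρ / (j + 1) with hr
  have hrlt : ∀ j, r j < ρ := fun j => by
    have : 0 < ρ / (j + 1) := by positivity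
    simp only [hr]
    linarith
  have hr0 : ∀ j, 0 ≤ r j := fun j => by
    have : ρ / (j + 1) ≤ ρ := div_le_self hρ.le (by have : (0 : ℝ) ≤ j := j.cast_nonneg; linarith)
    simp only [hr]
    linarith
  have hrmono : Monotone r := fun i j hij => by
    simp only [hr]
    gcongr
  have hrlim : Filter.Tendsto r Filter.atTop (nhds ρ) := by
    have := ((tendsto_one_div_add_atTop_nhds_zero_nat (𝕜 := ℝ)).const_mul ρ).const_sub ρ
    simpa [hr, div_eq_mul_inv] using this
  have hmem : ∀ x ∈ ball (0 : EuclideanSpace ℝ (Fin n)) ρ, ∃ j, x ∈ ball 0 (r j) := fun x hx =>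
    (hrlim.eventually (lt_mem_nhds hx)).exists
  have hU : ball (0 : EuclideanSpace ℝ (Fin n)) ρ = ⋃ j, ball 0 (r j) := by
    refine subset_antisymm (fun x hx => mem_iUnion.2 (hmem x hx)) ?_
    exact iUnion_subset fun j => ball_subset_ball (hrlt j).le
  have hbmono : Monotone fun j => ball (0 : EuclideanSpace ℝ (Fin n)) (r j) := fun i j hij =>
    ball_subset_ball (hrmono hij)
  filter_upwards [ae_all_iff.2 fun j => hG.ae_lintegral_enorm_sub_le_of_lt hn hf (hrlt j)]
    with x hx hxρ
  obtain ⟨j₀, hj₀⟩ := hmem x hxρ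
  conv_lhs => rw [hU]
  rw [setLIntegral_iUnion_of_directed _ hbmono.directed_le]
  refine iSup_le fun j => ?_
  calc ∫⁻ y in ball 0 (r j), ‖f x - f y‖ₑ
      ≤ ∫⁻ y in ball 0 (r (max j j₀)), ‖f x - f y‖ₑ :=
        lintegral_mono_set (hbmono (le_max_left j j₀))
    _ ≤ ENNReal.ofReal ((2 * r (max j j₀)) ^ n / n) *
          ∫⁻ z in ball 0 ρ, rieszKernel (x - z) * ‖G z‖ₑ :=
        hx _ (hbmono (le_max_right j j₀) hj₀)
    _ ≤ _ := by
        gcongr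
        · exact mul_nonneg two_pos.le (hr0 _)
        · exact (hrlt _).le

/-! ### The Poincaré–Sobolev inequality -/

theorem enorm_sub_setAverage_le {X : Type*} [MeasurableSpace X] {μ : Measure X} {B : Set X}
    (hB0 : μ B ≠ 0) (hB : μ B ≠ ⊤) {f : X → ℝ} (hf : IntegrableOn f B μ) (x : X) :
    ‖f x - ⨍ y in B, f y ∂μ‖ₑ ≤ (μ B)⁻¹ * ∫⁻ y in B, ‖f x - f y‖ₑ ∂μ := by
  have hreal : μ.real B ≠ 0 := (ENNReal.toReal_pos hB0 hB).ne'
  have hc : IntegrableOn (fun _ => f x) B μ := integrableOn_const hB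
  have h1 : f x - ⨍ y in B, f y ∂μ = (μ.real B)⁻¹ * ∫ y in B, (f x - f y) ∂μ := by
    rw [setAverage_eq, integral_sub hc hf, setIntegral_const, smul_eq_mul,
      smul_eq_mul, mul_sub, inv_mul_cancel_left₀ hreal]
  rw [h1, enorm_mul, enorm_inv hreal, Measure.real, Real.enorm_eq_ofReal ENNReal.toReal_nonneg,
    ENNReal.ofReal_toReal hB]
  gcongr
  exact enorm_integral_le_lintegral_enorm _

theorem lemma2p1 (n : ℕ) (p : ℝ) (q : ℝ≥0∞) (hp : 1 < p) (hpn : p < (n : ℝ)) (hq : 1 ≤ q) :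
    ∃ C : ℝ≥0, ∀ ρ : ℝ, 0 < ρ →
      ∀ (f : EuclideanSpace ℝ (Fin n) → ℝ)
        (G : EuclideanSpace ℝ (Fin n) → EuclideanSpace ℝ (Fin n)),
        IntegrableOn f (closedBall 0 ρ) → HasWeakGradientOn f G (ball 0 ρ) →
          lorentzNorm (fun x => f x - ⨍ y in closedBall 0 ρ, f y)
              (ENNReal.ofReal (p * n / (n - p))) q (closedBall 0 ρ)
            ≤ C * lorentzNorm G (ENNReal.ofReal p) q (closedBall 0 ρ) := by
  have hn : 2 ≤ n := by
    have : (1 : ℝ) < n := hp.trans hpn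
    exact_mod_cast this
  have hn0 : (0 : ℝ) < n := by linarith
  have hnt : Nontrivial (EuclideanSpace ℝ (Fin n)) :=
    Module.nontrivial_of_finrank_pos (R := ℝ) (by rw [finrank_euclideanSpace_fin]; omega)
  obtain ⟨C, hC0, hC⟩ := exists_lintegral_rieszKernel_le hn
  set v := volume (ball (0 : EuclideanSpace ℝ (Fin n)) 1) with hv
  have hv0 : v ≠ 0 := (measure_ball_pos volume _ one_pos).ne'
  have hvt : v ≠ ⊤ := measure_ball_lt_top.ne
  obtain ⟨K, hK⟩ : ∃ K : ℝ≥0, (K : ℝ≥0∞) = v⁻¹ * ENNReal.ofReal (2 ^ n / n) :=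
    ⟨_, ENNReal.coe_toNNReal (ENNReal.mul_ne_top (ENNReal.inv_ne_top.2 hv0) ENNReal.ofReal_ne_top)⟩
  have hK0 : 0 < K := by
    rw [← ENNReal.coe_pos, hK]
    refine ENNReal.mul_pos (ENNReal.inv_ne_zero.2 hvt) ?_
    rw [Ne, ENNReal.ofReal_eq_zero, not_le]
    positivity
  have hθ : (1 / n : ℝ) < p⁻¹ := by
    rw [one_div]
    exact inv_strictAnti₀ (by linarith) hpn
  obtain ⟨H, hH⟩ : ∃ H : ℝ≥0, (H : ℝ≥0∞) = ∫⁻ u in Ioi (0 : ℝ), hardyWeight (1 / n) p⁻¹ u :=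
    ⟨_, ENNReal.coe_toNNReal (lintegral_hardyWeight_ne_top (inv_lt_one_of_one_lt₀ hp) hθ)⟩
  refine ⟨2 * K * C * H, fun ρ hρ f G hf hG => ?_⟩
  have hfb : IntegrableOn f (ball 0 ρ) := hf.mono_set ball_subset_closedBall
  have hae : (closedBall (0 : EuclideanSpace ℝ (Fin n)) ρ) =ᵐ[volume] ball 0 ρ :=
    (ae_eq_of_subset_of_measure_ge ball_subset_closedBall
      (Measure.addHaar_closedBall_eq_addHaar_ball volume 0 ρ).le
      measurableSet_ball.nullMeasurableSet measure_closedBall_lt_top.ne).symm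
  have hrestrict : volume.restrict (closedBall (0 : EuclideanSpace ℝ (Fin n)) ρ)
      = volume.restrict (ball 0 ρ) := Measure.restrict_congr_set hae
  have hvol : volume (closedBall (0 : EuclideanSpace ℝ (Fin n)) ρ) = ENNReal.ofReal (ρ ^ n) * v := by
    rw [Measure.addHaar_closedBall _ _ hρ.le, finrank_euclideanSpace_fin]
  have hconst : (ENNReal.ofReal (ρ ^ n) * v)⁻¹ * ENNReal.ofReal ((2 * ρ) ^ n / n) = K := by
    have hρn : 0 < ρ ^ n := pow_pos hρ n
    rw [hK, ENNReal.mul_inv (Or.inr hvt) (Or.inr hv0), mul_comm (ENNReal.ofReal (ρ ^ n))⁻¹,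
      mul_assoc, ← ENNReal.ofReal_inv_of_pos hρn, ← ENNReal.ofReal_mul (by positivity)]
    congr 2
    rw [mul_pow]
    field_simp
  have hw : ∀ᵐ x ∂volume.restrict (closedBall (0 : EuclideanSpace ℝ (Fin n)) ρ),
      ‖f x - ⨍ y in closedBall 0 ρ, f y‖ₑ ≤
        K * ∫⁻ y in closedBall 0 ρ, rieszKernel (x - y) * ‖G y‖ₑ := by
    have h1 := hG.ae_lintegral_enorm_sub_le hn hρ hfb
    rw [← ae_restrict_iff' measurableSet_ball, ← hrestrict] at h1
    filter_upwards [h1] with x hx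
    refine (enorm_sub_setAverage_le (measure_closedBall_pos volume _ hρ).ne'
      measure_closedBall_lt_top.ne hf x).trans ?_
    rw [hvol, ← hconst, mul_assoc]
    gcongr
  have hGm : AEStronglyMeasurable G
      (volume.restrict (closedBall (0 : EuclideanSpace ℝ (Fin n)) ρ)) := by
    rw [hrestrict]
    exact hG.locallyIntegrableOn_grad.aestronglyMeasurable
  refine (lorentzNorm_le_of_decRearr_le hp hpn hq (2 * K * C) fun t ht =>
    decRearr_le_of_le_rieszKernel hn hC0 hC measurableSet_closedBall
      measure_closedBall_lt_top.ne hGm hK0 hw ht).trans_eq ?_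
  rw [← hH]
  simp only [ENNReal.coe_mul]
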